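/- Let $c>0$, $\varepsilon\in(0,1)$ and $h_0\in C^1([0,\infty))$. For a function $f$ on $[0,\infty)$ put $\bar f(r):=\frac1{r+\varepsilon}\int_0^r f(s)\,ds$. For a function $h_\varepsilon=h_\varepsilon(u,r)$, $u,r\ge 0$, define on each cone $u=\text{const}$ $$\nu_\varepsilon+\lambda_\varepsilon:=-4\pi\int_r^{\infty}\frac{(h_\varepsilon-\bar h_\varepsilon)^2}{s+\varepsilon}\,ds,\qquad g_\varepsilon:=\bigl(1-4c^2\pi(r+\varepsilon)^2\bar h_\varepsilon^2\bigr)e^{\nu_\varepsilon+\lambda_\varepsilon},$$ $$\bar g_\varepsilon(u,r):=\frac1{r+\varepsilon}\int_0^r g_\varepsilon(u,s)\,ds\ \bigl(=e^{\nu_\varepsilon-\lambda_\varepsilon}\bigr),\qquad m_\varepsilon:=\frac{r+\varepsilon}{2}\Bigl(1-\frac{\bar g_\varepsilon}{e^{\nu_\varepsilon+\lambda_\varepsilon}}\Bigr),$$ and set $D_\varepsilon:=\partial_u-\frac12\bar g_\varepsilon\,\partial_r$ (with one-sided $u$-derivatives at $u=0$) and $\xi_\varepsilon:=2(r+\varepsilon)D_\varepsilon\bar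 h_\varepsilon$. Assume that, for the quantities determined by the initial data $h_0$, the initial Bondi mass $\lim_{r\to\infty}m_{\varepsilon,0}(r)$ exists and is finite and $\bar g_{\varepsilon,0}>0$ on $(0,\infty)$. Let $h_\varepsilon$ be a global classical solution of the $\varepsilon$-regularized reduced Einstein equation with data $h_0$, that is, $h_\varepsilon\in C^1([0,\infty)\times[0,\infty))$, the integral defining $\nu_\varepsilon+\lambda_\varepsilon$ converges on $(0,\infty)$ for every $u\ge0$, $h_\varepsilon(0,\cdot)=h_0$, and for all $u\ge 0$, $r>0$, $$D_\varepsilon h_\varepsilon=\frac{1}{2(r+\varepsilon)}(g_\varepsilon-\bar g_\varepsilon)(h_\varepsilon-\bar h_\varepsilon)-\frac{c^2}{2}(r+\varepsilon)e^{\nu_\varepsilon+\lambda_\varepsilon}\bar h_\varepsilon .$$ Then the following hold. (a) For all $u\ge0$, $r>0$: $\bar g_\varepsilon>0$, the partial derivatives of $m_\varepsilon$ and $\bar h_\varepsilon$ in $u$ and $r$ exist, and $$D_\varepsilon m_\varepsilon=-\frac{4\pi}{e^{\nu_\varepsilon+\lambda_\varepsilon}}(r+\varepsilon)^2(D_\varepsilon\bar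 h_\varepsilon)^2-c^2\pi(r+\varepsilon)^2\bar h_\varepsilon^2\,\bar g_\varepsilon .$$ (b) Let $\delta>0$, $u_1\ge 0$ and $r_1>\delta$. There is a characteristic curve $\chi_\varepsilon:[0,u_1]\to(0,\infty)$ with $\chi_\varepsilon'(u)=-\frac12\bar g_\varepsilon(u,\chi_\varepsilon(u))$ and $\chi_\varepsilon(u_1)=r_1$, and for any such curve, with $r_{0,\varepsilon}:=\chi_\varepsilon(0)$ and $\mathcal O_{\varepsilon,\delta}(u_1,r_1):=\{(u,r): 0<u<u_1,\ \delta<r<\chi_\varepsilon(u)\}$, all the integrals below converge and $$\int_\delta^{r_1}\Bigl(\frac{e^{\nu_\varepsilon+\lambda_\varepsilon}}{\bar g_\varepsilon}\Bigr)(u_1,r)\,dr+2\pi\iint_{\mathcal O_{\varepsilon,\delta}(u_1,r_1)}\frac{e^{\nu_\varepsilon+\lambda_\varepsilon}}{\bar g_\varepsilon^2}\,\frac{\xi_\varepsilon^2}{r+\varepsilon}\,dr\,du+\frac12\int_0^{u_1}e^{(\nu_\varepsilon+\lambda_\varepsilon)(u,\delta)}\,du=\int_\delta^{r_{0,\varepsilon}}\Bigl(\frac{e^{\nu_\varepsilon+\lambda_\varepsilon}}{\bar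 g_\varepsilon}\Bigr)(0,r)\,dr .$$ -/

import Mathlib

open Set Filter Topology MeasureTheory

noncomputable section

/-! Quantities attached to one light cone. The argument `f : ℝ → ℝ` is the restriction
`r ↦ h u r` of the matter field to a cone `u = const`; only its values on `[0, ∞)` matter. -/

/-- The regularized mean `f̄(r) = (1 / (r + ε)) ∫₀ʳ f`. -/
def epsMean (ε : ℝ) (f : ℝ → ℝ) (r : ℝ) : ℝ :=
  1 / (r + ε) * ∫ s in (0 : ℝ)..r, f s

/-- The density `(f - f̄)² / (s + ε)` whose tail integrals define `ν + λ`. -/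
def metricDensity (ε : ℝ) (f : ℝ → ℝ) (s : ℝ) : ℝ :=
  (f s - epsMean ε f s) ^ 2 / (s + ε)

/-- `ν + λ = -4π ∫_r^∞ (f - f̄)² / (s + ε) ds`. -/
def nuPlusLam (ε : ℝ) (f : ℝ → ℝ) (r : ℝ) : ℝ :=
  -4 * Real.pi * ∫ s in Ioi r, metricDensity ε f s

/-- `g = (1 - 4 c² π (r + ε)² f̄²) e^{ν + λ}`. -/
def coefG (ε c : ℝ) (f : ℝ → ℝ) (r : ℝ) : ℝ :=
  (1 - 4 * c ^ 2 * Real.pi * (r + ε) ^ 2 * epsMean ε f r ^ 2) * Real.exp (nuPlusLam ε f r)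

/-- `ḡ`, the regularized mean of `g`; the coefficients `ν` and `λ` are separately determined
by `ḡ = e^{ν - λ}` wherever `ḡ > 0`. -/
def coefGbar (ε c : ℝ) (f : ℝ → ℝ) (r : ℝ) : ℝ :=
  epsMean ε (coefG ε c f) r

/-- The regularized Hawking mass `m = ((r + ε) / 2) (1 - ḡ / e^{ν + λ})`. -/
def hawkingMass (ε c : ℝ) (f : ℝ → ℝ) (r : ℝ) : ℝ :=
  (r + ε) / 2 * (1 - coefGbar ε c f r / Real.exp (nuPlusLam ε f r))

/-! Spacetime quantities attached to a field `h u r`, with `u, r ≥ 0`. -/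

/-- The null derivative `D F = ∂_u F - (1/2) ḡ ∂_r F` of a function `F` of `(u, r)` with
respect to the metric coefficient `ḡ` generated by `h`. At `u = 0` the derivative in `u` is
one-sided. -/
def nullDeriv (ε c : ℝ) (h : ℝ → ℝ → ℝ) (F : ℝ → ℝ → ℝ) (u r : ℝ) : ℝ :=
  derivWithin (fun v => F v r) (Ici 0) u
    - 1 / 2 * coefGbar ε c (h u) r * deriv (fun s => F u s) r

/-- Both partial derivatives that occur in `nullDeriv` exist at `(u, r)`. -/
def HasPartials (F : ℝ → ℝ → ℝ) (u r : ℝ) : Prop :=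
  DifferentiableWithinAt ℝ (fun v => F v r) (Ici 0) u ∧ DifferentiableAt ℝ (fun s => F u s) r

/-- `h` is a global classical solution of the regularized reduced Einstein equation with
initial data `h₀` on the cone `u = 0`. -/
structure IsGlobalClassicalSolution (ε c : ℝ) (h₀ : ℝ → ℝ) (h : ℝ → ℝ → ℝ) : Prop where
  /-- `h` is `C¹` on `[0, ∞) × [0, ∞)`. -/
  contDiffOn : ContDiffOn ℝ 1 (fun p : ℝ × ℝ => h p.1 p.2) (Ici 0 ×ˢ Ici 0)
  /-- The integral defining `ν + λ` converges on every cone. -/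
  integrable : ∀ u, 0 ≤ u → IntegrableOn (metricDensity ε (h u)) (Ioi 0)
  /-- The evolution equation holds for all `u ≥ 0` and `r > 0`. -/
  evolution : ∀ u r, 0 ≤ u → 0 < r →
    nullDeriv ε c h h u r
      = 1 / (2 * (r + ε)) * (coefG ε c (h u) r - coefGbar ε c (h u) r)
          * (h u r - epsMean ε (h u) r)
        - c ^ 2 / 2 * (r + ε) * Real.exp (nuPlusLam ε (h u) r) * epsMean ε (h u) r
  /-- The initial condition. -/
  initial : ∀ r, 0 ≤ r → h 0 r = h₀ r

/-- `ξ = 2 (r + ε) D h̄`. -/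
def xiField (ε c : ℝ) (h : ℝ → ℝ → ℝ) (u r : ℝ) : ℝ :=
  2 * (r + ε) * nullDeriv ε c h (fun v s => epsMean ε (h v) s) u r

/-- `χ` is, on `[0, u₁]`, a characteristic curve through `(u₁, r₁)`: it stays in `r > 0`, solves
`χ' = -(1/2) ḡ(u, χ)` there, and `χ u₁ = r₁`. -/
structure IsCharacteristic (ε c : ℝ) (h : ℝ → ℝ → ℝ) (u₁ r₁ : ℝ) (χ : ℝ → ℝ) : Prop where
  endpoint : χ u₁ = r₁
  pos : ∀ u ∈ Icc 0 u₁, 0 < χ u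
  ode : ∀ u ∈ Icc 0 u₁,
    HasDerivWithinAt χ (-(1 / 2) * coefGbar ε c (h u) (χ u)) (Icc 0 u₁) u

/-- The domain `{(u, r) : 0 < u < u₁, δ < r < χ u}`. -/
def charDomain (δ u₁ : ℝ) (χ : ℝ → ℝ) : Set (ℝ × ℝ) :=
  {p | 0 < p.1 ∧ p.1 < u₁ ∧ δ < p.2 ∧ p.2 < χ p.1}

/-- The function `e^{ν + λ} / ḡ`. -/
def metricRatio (ε c : ℝ) (h : ℝ → ℝ → ℝ) (u r : ℝ) : ℝ :=
  Real.exp (nuPlusLam ε (h u) r) / coefGbar ε c (h u) r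

/-- The function `(e^{ν + λ} / ḡ²) (ξ² / (r + ε))`. -/
def fluxDensity (ε c : ℝ) (h : ℝ → ℝ → ℝ) (u r : ℝ) : ℝ :=
  Real.exp (nuPlusLam ε (h u) r) / coefGbar ε c (h u) r ^ 2
    * (xiField ε c h u r ^ 2 / (r + ε))

end

noncomputable section

/-- `F` and `F'` are jointly continuous on the plane, and `F'` is the derivative of `F` in the
first variable. -/
structure HasContDerivFst (F F' : ℝ → ℝ → ℝ) : Prop where
  cont : Continuous fun p : ℝ × ℝ => F p.1 p.2
  cont' : Continuous fun p : ℝ × ℝ => F' p.1 p.2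
  deriv : ∀ u r, HasDerivAt (fun v => F v r) (F' u r) u

namespace HasContDerivFst

variable {F F' G G' : ℝ → ℝ → ℝ}

theorem of_snd {f : ℝ → ℝ} (hf : Continuous f) :
    HasContDerivFst (fun _ r => f r) (fun _ _ => 0) where
  cont := hf.comp continuous_snd
  cont' := continuous_const
  deriv u r := hasDerivAt_const u (f r)

theorem sub (hF : HasContDerivFst F F') (hG : HasContDerivFst G G') :
    HasContDerivFst (fun u r => F u r - G u r) (fun u r => F' u r - G' u r) where
  cont := hF.cont.sub hG.cont
  cont' := hF.cont'.sub hG.cont'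
  deriv u r := (hF.deriv u r).sub (hG.deriv u r)

theorem mul (hF : HasContDerivFst F F') (hG : HasContDerivFst G G') :
    HasContDerivFst (fun u r => F u r * G u r)
      (fun u r => F' u r * G u r + F u r * G' u r) where
  cont := hF.cont.mul hG.cont
  cont' := (hF.cont'.mul hG.cont).add (hF.cont.mul hG.cont')
  deriv u r := (hF.deriv u r).mul (hG.deriv u r)

theorem div (hF : HasContDerivFst F F') (hG : HasContDerivFst G G') (h0 : ∀ u r, G u r ≠ 0) :
    HasContDerivFst (fun u r => F u r / G u r)
      (fun u r => (F' u r * G u r - F u r * G' u r) / G u r ^ 2) where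
  cont := hF.cont.div hG.cont fun p => h0 p.1 p.2
  cont' := ((hF.cont'.mul hG.cont).sub (hF.cont.mul hG.cont')).div (hG.cont.pow 2)
    fun p => pow_ne_zero 2 (h0 p.1 p.2)
  deriv u r := (hF.deriv u r).div (hG.deriv u r) (h0 u r)

theorem exp (hF : HasContDerivFst F F') :
    HasContDerivFst (fun u r => Real.exp (F u r)) (fun u r => Real.exp (F u r) * F' u r) where
  cont := Real.continuous_exp.comp hF.cont
  cont' := (Real.continuous_exp.comp hF.cont).mul hF.cont'
  deriv u r := (hF.deriv u r).exp

theorem congr_deriv (hF : HasContDerivFst F F') (h : ∀ u r, F' u r = G' u r) :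
    HasContDerivFst F G' := by
  obtain rfl : F' = G' := funext fun u => funext fun r => h u r
  exact hF

theorem continuous_snd (hF : HasContDerivFst F F') (u : ℝ) : Continuous (F u) :=
  hF.cont.comp (by fun_prop : Continuous fun r : ℝ => (u, r))

theorem continuous_snd' (hF : HasContDerivFst F F') (u : ℝ) : Continuous (F' u) :=
  hF.cont'.comp (by fun_prop : Continuous fun r : ℝ => (u, r))

theorem continuous_fst (hF : HasContDerivFst F F') (r : ℝ) : Continuous fun u => F u r :=
  hF.cont.comp (by fun_prop : Continuous fun u : ℝ => (u, r))

theorem primitive (hF : HasContDerivFst F F') (b : ℝ) :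
    HasContDerivFst (fun u r => ∫ s in b..r, F u s) (fun u r => ∫ s in b..r, F' u s) where
  cont := intervalIntegral.continuous_parametric_intervalIntegral_of_continuous
    (f := fun (p : ℝ × ℝ) s => F p.1 s)
    (hF.cont.comp (by fun_prop : Continuous fun x : (ℝ × ℝ) × ℝ => (x.1.1, x.2)))
    _root_.continuous_snd
  cont' := intervalIntegral.continuous_parametric_intervalIntegral_of_continuous
    (f := fun (p : ℝ × ℝ) s => F' p.1 s)
    (hF.cont'.comp (by fun_prop : Continuous fun x : (ℝ × ℝ) × ℝ => (x.1.1, x.2)))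
    _root_.continuous_snd
  deriv u r := by
    obtain ⟨C, hC⟩ := ((isCompact_Icc (a := u - 1) (b := u + 1)).prod
      (isCompact_uIcc (a := b) (b := r))).exists_bound_of_continuousOn hF.cont'.continuousOn
    refine (intervalIntegral.hasDerivAt_integral_of_dominated_loc_of_deriv_le
      (bound := fun _ => C) (Icc_mem_nhds (a := u - 1) (b := u + 1) (by linarith) (by linarith))
      (Eventually.of_forall fun v => (hF.continuous_snd v).aestronglyMeasurable)
      ((hF.continuous_snd u).intervalIntegrable _ _)
      (hF.continuous_snd' u).aestronglyMeasurable
      (Eventually.of_forall fun t ht v hv => hC (v, t) ⟨hv, uIoc_subset_uIcc ht⟩)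
      (by simp) (Eventually.of_forall fun t _ v _ => hF.deriv v t)).2

/-- Chain rule along a curve `u ↦ (u, χ u)`. -/
theorem hasDerivWithinAt_comp_curve (hF : HasContDerivFst F F') {χ : ℝ → ℝ} {S : Set ℝ}
    {u χ' : ℝ} (hχ : HasDerivWithinAt χ χ' S u)
    (hG : ∀ᶠ p : ℝ × ℝ in 𝓝 (u, χ u), HasDerivAt (F p.1) (G p.1 p.2) p.2)
    (hGc : ContinuousAt (fun p : ℝ × ℝ => G p.1 p.2) (u, χ u)) :
    HasDerivWithinAt (fun v => F v (χ v)) (F' u (χ u) + χ' * G u (χ u)) S u := by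
  have key := hasStrictFDerivAt_uncurry_coprod (𝕜 := ℝ) (u := (u, χ u)) (f := F)
    (f₁ := fun v r => ContinuousLinearMap.toSpanSingleton ℝ (F' v r))
    (f₂ := fun v r => ContinuousLinearMap.toSpanSingleton ℝ (G v r))
    (Eventually.of_forall fun p => (hF.deriv p.1 p.2).hasFDerivAt)
    (hG.mono fun p hp => hp.hasFDerivAt)
    (by
      have h1 : Continuous fun x : ℝ => ContinuousLinearMap.toSpanSingleton ℝ x :=
        (ContinuousLinearMap.toSpanSingletonCLE (𝕜 := ℝ) (E := ℝ)).continuous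
      exact (h1.comp hF.cont').continuousAt)
    (by
      have h1 : Continuous fun x : ℝ => ContinuousLinearMap.toSpanSingleton ℝ x :=
        (ContinuousLinearMap.toSpanSingletonCLE (𝕜 := ℝ) (E := ℝ)).continuous
      exact h1.continuousAt.comp hGc)
  have h2 := key.hasFDerivAt.comp_hasDerivWithinAt_of_eq u
    ((hasDerivWithinAt_id u S).prodMk hχ) rfl
  refine h2.congr_deriv ?_
  simp [Function.HasUncurry.uncurry]

/-- Leibniz rule with a moving upper end point. -/
theorem hasDerivWithinAt_integral_curve (hF : HasContDerivFst F F') (b : ℝ) {χ : ℝ → ℝ}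
    {S : Set ℝ} {u χ' : ℝ} (hχ : HasDerivWithinAt χ χ' S u) :
    HasDerivWithinAt (fun v => ∫ s in b..χ v, F v s)
      ((∫ s in b..χ u, F' u s) + χ' * F u (χ u)) S u :=
  (hF.primitive b).hasDerivWithinAt_comp_curve (G := F) hχ
    (Eventually.of_forall fun p =>
      ((hF.continuous_snd p.1).integral_hasStrictDerivAt b p.2).hasDerivAt)
    hF.cont.continuousAt

end HasContDerivFst

/-- Extension of a function on `[0, ∞) × [b, ∞)` to the plane, affine in the first variable for
negative values and constant in the second one below `b`. -/
def quadrantExt (b : ℝ) (F F' : ℝ → ℝ → ℝ) (u r : ℝ) : ℝ :=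
  F (max u 0) (max r b) + min u 0 * F' 0 (max r b)

theorem quadrantExt_eq {b u r : ℝ} (F F' : ℝ → ℝ → ℝ) (hu : 0 ≤ u) (hr : b ≤ r) :
    quadrantExt b F F' u r = F u r := by
  simp [quadrantExt, hu, hr]

theorem continuous_clamp {b : ℝ} {F : ℝ → ℝ → ℝ}
    (hF : ContinuousOn (fun p : ℝ × ℝ => F p.1 p.2) (Ici 0 ×ˢ Ici b)) :
    Continuous fun p : ℝ × ℝ => F (max p.1 0) (max p.2 b) :=
  hF.comp_continuous (f := fun p : ℝ × ℝ => (max p.1 0, max p.2 b)) (by fun_prop)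
    fun p => mk_mem_prod (mem_Ici.2 (le_max_right _ _)) (mem_Ici.2 (le_max_right _ _))

theorem hasContDerivFst_quadrantExt {b : ℝ} {F F' : ℝ → ℝ → ℝ}
    (hF : ContinuousOn (fun p : ℝ × ℝ => F p.1 p.2) (Ici 0 ×ˢ Ici b))
    (hF' : ContinuousOn (fun p : ℝ × ℝ => F' p.1 p.2) (Ici 0 ×ˢ Ici b))
    (hd : ∀ u r, 0 ≤ u → b ≤ r → HasDerivWithinAt (fun v => F v r) (F' u r) (Ici 0) u) :
    HasContDerivFst (quadrantExt b F F') (fun u r => F' (max u 0) (max r b)) where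
  cont := by
    have h1 := continuous_clamp hF
    have h2 : Continuous fun p : ℝ × ℝ => F' 0 (max p.2 b) := by
      simpa [Function.comp_def] using
        (continuous_clamp hF').comp (by fun_prop : Continuous fun p : ℝ × ℝ => ((0 : ℝ), p.2))
    have h3 : Continuous fun p : ℝ × ℝ => min p.1 0 := by fun_prop
    exact h1.add (h3.mul h2)
  cont' := continuous_clamp hF'
  deriv u r := by
    have hb : b ≤ max r b := le_max_right _ _
    have hR : ∀ u, 0 ≤ u → HasDerivWithinAt (fun v => quadrantExt b F F' v r)
        (F' u (max r b)) (Ici 0) u := fun u hu => by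
      refine (hd u _ hu hb).congr_of_mem (fun v hv => ?_) hu
      simp [quadrantExt, mem_Ici.1 hv]
    have hL : ∀ u, u ≤ 0 → HasDerivWithinAt (fun v => quadrantExt b F F' v r)
        (F' 0 (max r b)) (Iic 0) u := fun u hu => by
      have h1 : HasDerivWithinAt (fun v => F 0 (max r b) + v * F' 0 (max r b))
          (F' 0 (max r b)) (Iic 0) u := by
        simpa using (((hasDerivAt_id u).mul_const (F' 0 (max r b))).const_add
          (F 0 (max r b))).hasDerivWithinAt
      refine h1.congr_of_mem (fun v hv => ?_) hu
      simp [quadrantExt, mem_Iic.1 hv]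
    rcases lt_trichotomy u 0 with hu | rfl | hu
    · simpa [hu.le] using (hL u hu.le).hasDerivAt (Iic_mem_nhds hu)
    · have := (hL 0 le_rfl).union (hR 0 le_rfl)
      simpa [Iic_union_Ici] using this
    · simpa [hu.le] using (hR u hu.le).hasDerivAt (Ici_mem_nhds hu)

/-- A solution of `z' = p z` on `(0, ∞)`, continuous at `0` and vanishing there, is zero. -/
theorem eq_zero_of_linear_ode {z p P : ℝ → ℝ} (hz : ContinuousOn z (Ici 0))
    (hP : ContinuousOn P (Ici 0)) (hz' : ∀ r, 0 < r → HasDerivAt z (p r * z r) r)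
    (hP' : ∀ r, 0 < r → HasDerivAt P (p r) r) (h0 : z 0 = 0) {r : ℝ} (hr : 0 ≤ r) : z r = 0 := by
  have hc : ContinuousOn (fun r => Real.exp (-P r) * z r) (Icc 0 r) :=
    ((hP.neg.rexp).mul hz).mono Icc_subset_Ici_self
  have hd : ∀ x ∈ Ico 0 r, 0 < x →
      HasDerivAt (fun r => Real.exp (-P r) * z r) 0 x := fun x _ hx => by
    refine ((hP' x hx).neg.exp.mul (hz' x hx)).congr_deriv ?_
    simp only [Pi.neg_apply]
    ring
  rcases hr.eq_or_lt with rfl | hr'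
  · exact h0
  obtain ⟨x, hx, hx'⟩ := exists_hasDerivAt_eq_slope (fun r => Real.exp (-P r) * z r) (fun _ => 0)
    hr' hc fun x hx => hd x ⟨hx.1.le, hx.2⟩ hx.1
  have : Real.exp (-P r) * z r = 0 := by
    have h1 : r - 0 ≠ 0 := by linarith
    field_simp at hx'
    simp [h0] at hx'
    simp [hx']
  exact (mul_eq_zero.1 this).resolve_left (Real.exp_pos _).ne'

theorem ContDiffOn.exists_quadrant_partials {h : ℝ → ℝ → ℝ}
    (hh : ContDiffOn ℝ 1 (fun p : ℝ × ℝ => h p.1 p.2) (Ici 0 ×ˢ Ici 0)) :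
    ∃ hu hr : ℝ → ℝ → ℝ, ContinuousOn (fun p : ℝ × ℝ => hu p.1 p.2) (Ici 0 ×ˢ Ici 0) ∧
      (∀ u r, 0 ≤ u → 0 ≤ r → HasDerivWithinAt (fun v => h v r) (hu u r) (Ici 0) u) ∧
      ∀ u r, 0 ≤ u → 0 < r → HasDerivAt (h u) (hr u r) r := by
  set Q : Set (ℝ × ℝ) := Ici 0 ×ˢ Ici 0
  set D := fderivWithin ℝ (fun p : ℝ × ℝ => h p.1 p.2) Q
  have hQ : UniqueDiffOn ℝ Q := (uniqueDiffOn_Ici 0).prod (uniqueDiffOn_Ici 0)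
  have hD : ∀ p ∈ Q, HasFDerivWithinAt (fun p : ℝ × ℝ => h p.1 p.2) (D p) Q p := fun p hp =>
    (hh.differentiableOn one_ne_zero p hp).hasFDerivWithinAt
  refine ⟨fun u r => D (u, r) (1, 0), fun u r => D (u, r) (0, 1), ?_, ?_, ?_⟩
  · exact (hh.continuousOn_fderivWithin hQ le_rfl).clm_apply continuousOn_const
  · intro u r hu hr
    exact (hD (u, r) ⟨hu, hr⟩).comp_hasDerivWithinAt (t := Q) (f := fun v => (v, r)) u
      ((hasDerivWithinAt_id u (Ici 0)).prodMk (hasDerivWithinAt_const u _ r))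
      fun v hv => ⟨hv, hr⟩
  · intro u r hu hr
    exact ((hD (u, r) ⟨hu, hr.le⟩).comp_hasDerivWithinAt (t := Q) (f := fun s => (u, s)) r
      ((hasDerivWithinAt_const r (Ici 0) u).prodMk (hasDerivWithinAt_id r _))
      fun v hv => ⟨hu, hv⟩).hasDerivAt (Ici_mem_nhds hr)

/-! Quantities on one cone that depend only on the restriction of the field to `[0, r]`. The
radius is clamped at the axis, which makes all of them continuous on the whole line. -/

/-- The regularized radius `r + ε`, clamped at `r = 0`. -/
def coneRad (ε r : ℝ) : ℝ := max r 0 + ε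

/-- The regularized mean `f̄`. -/
def coneMean (ε : ℝ) (f : ℝ → ℝ) (r : ℝ) : ℝ := (∫ s in (0 : ℝ)..r, f s) / coneRad ε r

/-- The deviation `f - f̄`. -/
def coneDev (ε : ℝ) (f : ℝ → ℝ) (r : ℝ) : ℝ := f r - coneMean ε f r

/-- The density `4π (f - f̄)² / (r + ε)`. -/
def coneDensity (ε : ℝ) (f : ℝ → ℝ) (r : ℝ) : ℝ :=
  4 * Real.pi * (coneDev ε f r * coneDev ε f r) / coneRad ε r

/-- The increment of `ν + λ` from the axis to `r`. -/
def conePot (ε : ℝ) (f : ℝ → ℝ) (r : ℝ) : ℝ := ∫ s in (0 : ℝ)..r, coneDensity ε f s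

/-- The factor `1 - 4π c² (r + ε)² f̄²`. -/
def coneSource (ε c : ℝ) (f : ℝ → ℝ) (r : ℝ) : ℝ :=
  1 - 4 * c ^ 2 * Real.pi * coneRad ε r ^ 2 * (coneMean ε f r * coneMean ε f r)

/-- The quantity `(r + ε) ḡ e^{-(ν + λ)} = r + ε - 2m`. -/
def coneW (ε c : ℝ) (f : ℝ → ℝ) (r : ℝ) : ℝ :=
  (∫ s in (0 : ℝ)..r, coneSource ε c f s * Real.exp (conePot ε f s)) / Real.exp (conePot ε f r)

/-- The first variation of `coneDensity` at `f` in the direction `f'`. -/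
def coneDensityVar (ε : ℝ) (f f' : ℝ → ℝ) (r : ℝ) : ℝ :=
  8 * Real.pi * (coneDev ε f r * coneDev ε f' r) / coneRad ε r

/-- The first variation of `conePot`. -/
def conePotVar (ε : ℝ) (f f' : ℝ → ℝ) (r : ℝ) : ℝ := ∫ s in (0 : ℝ)..r, coneDensityVar ε f f' s

/-- The first variation of `coneSource`. -/
def coneSourceVar (ε c : ℝ) (f f' : ℝ → ℝ) (r : ℝ) : ℝ :=
  -(8 * c ^ 2 * Real.pi * coneRad ε r ^ 2 * (coneMean ε f r * coneMean ε f' r))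

/-- The first variation of `coneW`. -/
def coneWVar (ε c : ℝ) (f f' : ℝ → ℝ) (r : ℝ) : ℝ :=
  (∫ s in (0 : ℝ)..r, (coneSourceVar ε c f f' s * Real.exp (conePot ε f s)
      + coneSource ε c f s * (Real.exp (conePot ε f s) * conePotVar ε f f' s)))
    / Real.exp (conePot ε f r) - coneW ε c f r * conePotVar ε f f' r

section Basic

variable {ε : ℝ} (hε : 0 < ε)
include hε

theorem coneRad_pos (r : ℝ) : 0 < coneRad ε r := add_pos_of_nonneg_of_pos (le_max_right _ _) hε

theorem coneRad_ne (r : ℝ) : coneRad ε r ≠ 0 := (coneRad_pos hε r).ne'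

end Basic

theorem coneRad_eq (ε : ℝ) {r : ℝ} (hr : 0 ≤ r) : coneRad ε r = r + ε := by
  simp [coneRad, hr]

theorem continuous_coneRad (ε : ℝ) : Continuous (coneRad ε) := by
  unfold coneRad
  fun_prop

theorem hasDerivAt_coneRad (ε : ℝ) {r : ℝ} (hr : 0 < r) : HasDerivAt (coneRad ε) 1 r := by
  refine ((hasDerivAt_id r).add_const ε).congr_of_eventuallyEq ?_
  filter_upwards [Ioi_mem_nhds hr] with s hs
  simp [coneRad_eq ε (mem_Ioi.1 hs).le]

theorem coneMean_eq {ε : ℝ} (f : ℝ → ℝ) {r : ℝ} (hr : 0 ≤ r) :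
    coneMean ε f r = epsMean ε f r := by
  rw [coneMean, epsMean, coneRad_eq ε hr]
  ring

/-! Continuity and derivatives along one cone. -/

section OneCone

variable {ε : ℝ} (hε : 0 < ε) (c : ℝ) {f f' : ℝ → ℝ} (hf : Continuous f)

theorem hasDerivAt_integral_zero {F : ℝ → ℝ} (hF : Continuous F) (r : ℝ) :
    HasDerivAt (fun x => ∫ s in (0 : ℝ)..x, F s) (F r) r :=
  (hF.integral_hasStrictDerivAt 0 r).hasDerivAt

include hε hf

theorem continuous_coneMean : Continuous (coneMean ε f) :=
  (intervalIntegral.continuous_primitive (fun _ _ => hf.intervalIntegrable _ _) 0).div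
    (continuous_coneRad ε) (coneRad_ne hε)

theorem continuous_coneDev : Continuous (coneDev ε f) := hf.sub (continuous_coneMean hε hf)

theorem continuous_coneDensity : Continuous (coneDensity ε f) :=
  (continuous_const.mul ((continuous_coneDev hε hf).mul (continuous_coneDev hε hf))).div
    (continuous_coneRad ε) (coneRad_ne hε)

theorem hasDerivAt_conePot (r : ℝ) : HasDerivAt (conePot ε f) (coneDensity ε f r) r :=
  hasDerivAt_integral_zero (continuous_coneDensity hε hf) r

theorem continuous_conePot : Continuous (conePot ε f) :=
  continuous_iff_continuousAt.2 fun r => (hasDerivAt_conePot hε hf r).continuousAt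

theorem continuous_coneSource : Continuous (coneSource ε c f) := by
  have h1 := continuous_coneMean hε hf
  have h2 := continuous_coneRad ε
  unfold coneSource
  fun_prop

theorem hasDerivAt_coneW (r : ℝ) : HasDerivAt (coneW ε c f)
    (coneSource ε c f r - coneDensity ε f r * coneW ε c f r) r := by
  have hP := hasDerivAt_conePot hε hf r
  have hE := (continuous_conePot hε hf).rexp
  have hQ := hasDerivAt_integral_zero
    (F := fun s => coneSource ε c f s * Real.exp (conePot ε f s))
    ((continuous_coneSource hε c hf).mul hE) r
  refine (hQ.div hP.exp (Real.exp_pos _).ne').congr_deriv ?_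
  simp only [coneW]
  have := (Real.exp_pos (conePot ε f r)).ne'
  field_simp

theorem continuous_coneW : Continuous (coneW ε c f) :=
  continuous_iff_continuousAt.2 fun r => (hasDerivAt_coneW hε c hf r).continuousAt

theorem hasDerivAt_coneMean {r : ℝ} (hr : 0 < r) :
    HasDerivAt (coneMean ε f) (coneDev ε f r / coneRad ε r) r := by
  refine ((hasDerivAt_integral_zero hf r).div (hasDerivAt_coneRad ε hr)
    (coneRad_ne hε r)).congr_deriv ?_
  have := coneRad_ne hε r
  simp only [coneDev, coneMean]
  field_simp

theorem hasDerivAt_coneDev {b r : ℝ} (hr : 0 < r) (hb : HasDerivAt f b r) :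
    HasDerivAt (coneDev ε f) (b - coneDev ε f r / coneRad ε r) r :=
  hb.sub (hasDerivAt_coneMean hε hf hr)

variable (hf' : Continuous f')
include hf'

theorem continuous_coneDensityVar : Continuous (coneDensityVar ε f f') :=
  (continuous_const.mul ((continuous_coneDev hε hf).mul (continuous_coneDev hε hf'))).div
    (continuous_coneRad ε) (coneRad_ne hε)

theorem hasDerivAt_conePotVar (r : ℝ) :
    HasDerivAt (conePotVar ε f f') (coneDensityVar ε f f' r) r :=
  hasDerivAt_integral_zero (continuous_coneDensityVar hε hf hf') r

theorem continuous_coneSourceVar : Continuous (coneSourceVar ε c f f') := by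
  have h1 := continuous_coneMean hε hf
  have h2 := continuous_coneRad ε
  have h3 := continuous_coneMean hε hf'
  unfold coneSourceVar
  fun_prop

theorem hasDerivAt_coneWVar (r : ℝ) : HasDerivAt (coneWVar ε c f f')
    (coneSourceVar ε c f f' r - coneDensity ε f r * coneWVar ε c f f' r
      - coneW ε c f r * coneDensityVar ε f f' r) r := by
  have hP := hasDerivAt_conePot hε hf r
  have hE := (continuous_conePot hε hf).rexp
  have hPV := hasDerivAt_conePotVar hε hf hf' r
  have hPVc : Continuous (conePotVar ε f f') := continuous_iff_continuousAt.2 fun r =>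
    (hasDerivAt_conePotVar hε hf hf' r).continuousAt
  have hQ := hasDerivAt_integral_zero
    (F := fun s => coneSourceVar ε c f f' s * Real.exp (conePot ε f s)
      + coneSource ε c f s * (Real.exp (conePot ε f s) * conePotVar ε f f' s))
    (((continuous_coneSourceVar hε c hf hf').mul hE).add
    ((continuous_coneSource hε c hf).mul (hE.mul hPVc))) r
  refine ((hQ.div hP.exp (Real.exp_pos _).ne').sub
    ((hasDerivAt_coneW hε c hf r).mul hPV)).congr_deriv ?_
  simp only [coneWVar]
  have := (Real.exp_pos (conePot ε f r)).ne'
  field_simp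
  ring

/-- The variation of `coneW` in the direction of the evolution: the integrated form of the mass
equation. Here `e` is the value of `e^{ν + λ}` on the axis. -/
theorem coneWVar_eq {e : ℝ} (he : 0 < e) {b : ℝ → ℝ}
    (hb : ∀ r, 0 < r → HasDerivAt f (b r) r)
    (hev : ∀ r, 0 < r → f' r
      = 1 / 2 * (e * Real.exp (conePot ε f r) * coneW ε c f r / coneRad ε r) * b r
        + 1 / (2 * coneRad ε r) * (coneSource ε c f r * (e * Real.exp (conePot ε f r))
            - e * Real.exp (conePot ε f r) * coneW ε c f r / coneRad ε r) * coneDev ε f r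
        - c ^ 2 / 2 * coneRad ε r * (e * Real.exp (conePot ε f r)) * coneMean ε f r)
    {r : ℝ} (hr : 0 ≤ r) :
    coneWVar ε c f f' r = 2 * Real.pi *
      ((2 * coneRad ε r * coneMean ε f' r
          - e * Real.exp (conePot ε f r) * coneW ε c f r / coneRad ε r * coneDev ε f r) ^ 2
          / (e * Real.exp (conePot ε f r))
        - e * Real.exp (conePot ε f r) * coneW ε c f r / coneRad ε r
          * (coneW ε c f r / coneRad ε r) * coneDev ε f r ^ 2) := by
  have hρ := continuous_coneRad ε
  have hρ0 := coneRad_ne hε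
  have hE : Continuous fun r => e * Real.exp (conePot ε f r) :=
    continuous_const.mul (continuous_conePot hε hf).rexp
  have hE0 : ∀ r, e * Real.exp (conePot ε f r) ≠ 0 := fun r =>
    (mul_pos he (Real.exp_pos _)).ne'
  set E : ℝ → ℝ := fun r => e * Real.exp (conePot ε f r) with hEdef
  set gb : ℝ → ℝ := fun r => E r * coneW ε c f r / coneRad ε r with hgb
  set ξ : ℝ → ℝ := fun r => 2 * (∫ s in (0 : ℝ)..r, f' s) - gb r * coneDev ε f r with hξ
  set y : ℝ → ℝ := fun r => 2 * Real.pi *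
    (ξ r ^ 2 / E r - gb r * (coneW ε c f r / coneRad ε r) * coneDev ε f r ^ 2) with hy
  have hW := continuous_coneW hε c hf
  have hk := continuous_coneDev hε hf
  have hgbc : Continuous gb := (hE.mul hW).div hρ hρ0
  have hξc : Continuous ξ := by
    have := intervalIntegral.continuous_primitive (μ := volume)
      (fun a b => hf'.intervalIntegrable a b) 0
    fun_prop
  have hyc : Continuous y := by
    have h1 : Continuous fun r => ξ r ^ 2 / E r := (hξc.pow 2).div hE hE0
    have h2 : Continuous fun r => coneW ε c f r / coneRad ε r := hW.div hρ hρ0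
    fun_prop
  have hWVc : Continuous (coneWVar ε c f f') := continuous_iff_continuousAt.2 fun r =>
    (hasDerivAt_coneWVar hε c hf hf' r).continuousAt
  have hEd : ∀ r, HasDerivAt E (E r * coneDensity ε f r) r := fun r =>
    ((hasDerivAt_conePot hε hf r).exp.const_mul e).congr_deriv (by simp only [hEdef]; ring)
  have hgbd : ∀ r, 0 < r →
      HasDerivAt gb ((coneSource ε c f r * E r - gb r) / coneRad ε r) r := fun r hr => by
    refine (((hEd r).mul (hasDerivAt_coneW hε c hf r)).div (hasDerivAt_coneRad ε hr)
      (hρ0 r)).congr_deriv ?_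
    have := hρ0 r
    simp only [hgb, Pi.mul_apply]
    field_simp
    ring
  have hξd : ∀ r, 0 < r → HasDerivAt ξ (gb r * coneDev ε f r / coneRad ε r
      - c ^ 2 * coneRad ε r * E r * coneMean ε f r) r := fun r hr => by
    refine (((hasDerivAt_integral_zero hf' r).const_mul 2).sub ((hgbd r hr).mul
      (hasDerivAt_coneDev hε hf hr (hb r hr)))).congr_deriv ?_
    rw [hev r hr]
    have := hρ0 r
    change 2 * (1 / 2 * gb r * b r + 1 / (2 * coneRad ε r) * (coneSource ε c f r * E r - gb r)
      * coneDev ε f r - c ^ 2 / 2 * coneRad ε r * E r * coneMean ε f r) - _ = _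
    field_simp
    ring
  have hz : coneWVar ε c f f' r - y r = 0 := by
    refine eq_zero_of_linear_ode (z := fun r => coneWVar ε c f f' r - y r)
      (p := fun r => -coneDensity ε f r) (P := fun r => -conePot ε f r)
      (hWVc.sub hyc).continuousOn (continuous_conePot hε hf).neg.continuousOn ?_
      (fun r _ => (hasDerivAt_conePot hε hf r).neg) ?_ hr
    · intro r hr
      have hyd := ((((hξd r hr).pow 2).div (hEd r) (hE0 r)).sub
        (((hgbd r hr).mul ((hasDerivAt_coneW hε c hf r).div (hasDerivAt_coneRad ε hr)
          (hρ0 r))).mul ((hasDerivAt_coneDev hε hf hr (hb r hr)).pow 2))).const_mul (2 * Real.pi)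
      refine ((hasDerivAt_coneWVar hε c hf hf' r).sub hyd).congr_deriv ?_
      have hfr := hev r hr
      change f' r = 1 / 2 * gb r * b r + 1 / (2 * coneRad ε r) *
        (coneSource ε c f r * E r - gb r) * coneDev ε f r
        - c ^ 2 / 2 * coneRad ε r * E r * coneMean ε f r at hfr
      have hmean : coneMean ε f' r
          = (ξ r + gb r * coneDev ε f r) / (2 * coneRad ε r) := by
        have := hρ0 r
        simp only [hξ, coneMean]
        field_simp
        ring
      have hgr : gb r = E r * coneW ε c f r / coneRad ε r := rfl
      have h1 := hρ0 r
      have h2 := hE0 r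
      change E r ≠ 0 at h2
      have hdev : coneDev ε f' r = f' r - coneMean ε f' r := rfl
      simp only [coneDensityVar, coneSourceVar, hdev, hmean, hfr, hy, hgr, coneDensity, Pi.mul_apply,
        Pi.pow_apply, Pi.div_apply]
      generalize ξ r = x
      generalize E r = E at h2
      generalize coneRad ε r = ρ at h1
      generalize coneWVar ε c f f' r = w'
      field_simp
      ring
    · simp [coneWVar, hy, hξ, hgb, coneW, conePotVar]
  have := sub_eq_zero.1 hz
  rw [this]
  have hρr := hρ0 r
  have hx : 2 * coneRad ε r * coneMean ε f' r = 2 * ∫ s in (0 : ℝ)..r, f' s := by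
    rw [coneMean]
    field_simp
  rw [hx]

end OneCone

namespace HasContDerivFst

variable {ε : ℝ} (hε : 0 < ε) (c : ℝ) {a a' : ℝ → ℝ → ℝ} (ha : HasContDerivFst a a')
include hε ha

theorem coneMean :
    HasContDerivFst (fun u => coneMean ε (a u)) (fun u => coneMean ε (a' u)) := by
  refine ((ha.primitive 0).div (of_snd (continuous_coneRad ε))
    fun _ => coneRad_ne hε).congr_deriv fun u r => ?_
  have := coneRad_ne hε r
  simp only [_root_.coneMean]
  field_simp
  ring

theorem coneDev : HasContDerivFst (fun u => coneDev ε (a u)) (fun u => coneDev ε (a' u)) :=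
  ha.sub (ha.coneMean hε)

theorem coneDensity : HasContDerivFst (fun u => coneDensity ε (a u))
    (fun u => coneDensityVar ε (a u) (a' u)) := by
  refine (((of_snd continuous_const).mul ((ha.coneDev hε).mul (ha.coneDev hε))).div
    (of_snd (continuous_coneRad ε)) fun _ => coneRad_ne hε).congr_deriv
      (F := fun u r => _root_.coneDensity ε (a u) r) fun u r => ?_
  have := coneRad_ne hε r
  simp only [coneDensityVar]
  field_simp
  ring

theorem conePot : HasContDerivFst (fun u => conePot ε (a u))
    (fun u => conePotVar ε (a u) (a' u)) :=
  (ha.coneDensity hε).primitive 0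

theorem coneSource : HasContDerivFst (fun u => coneSource ε c (a u))
    (fun u => coneSourceVar ε c (a u) (a' u)) := by
  have h1 : Continuous fun r => 4 * c ^ 2 * Real.pi * coneRad ε r ^ 2 :=
    continuous_const.mul ((continuous_coneRad ε).pow 2)
  refine ((of_snd continuous_const).sub ((of_snd h1).mul
    ((ha.coneMean hε).mul (ha.coneMean hε)))).congr_deriv
      (F := fun u r => _root_.coneSource ε c (a u) r) fun u r => ?_
  simp only [coneSourceVar]
  ring

theorem coneW : HasContDerivFst (fun u => coneW ε c (a u))
    (fun u => coneWVar ε c (a u) (a' u)) := by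
  have hP := (ha.conePot hε).exp
  refine ((((ha.coneSource hε c).mul hP).primitive 0).div hP
    fun u r => (Real.exp_pos _).ne').congr_deriv
      (F := fun u r => _root_.coneW ε c (a u) r) fun u r => ?_
  have := (Real.exp_pos (_root_.conePot ε (a u) r)).ne'
  simp only [coneWVar, _root_.coneW]
  field_simp

end HasContDerivFst

/-- A solution of the regularized equation written in terms of quantities defined on the whole
plane. The function `b` is the radial derivative of the field `a` and `L u` is the total variation
of `ν + λ` on the cone `u`. -/
structure IsConeFlow (ε c : ℝ) (a a' b : ℝ → ℝ → ℝ) (L : ℝ → ℝ) : Prop where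
  eps_pos : 0 < ε
  field : HasContDerivFst a a'
  radial : ∀ u r, 0 ≤ u → 0 < r → HasDerivAt (a u) (b u r) r
  tendsto : ∀ u, 0 ≤ u → Tendsto (conePot ε (a u)) atTop (𝓝 (L u))
  evolution : ∀ u r, 0 ≤ u → 0 < r → a' u r
      = 1 / 2 * (Real.exp (-L u) * Real.exp (conePot ε (a u) r) * coneW ε c (a u) r / coneRad ε r)
          * b u r
        + 1 / (2 * coneRad ε r) * (coneSource ε c (a u) r
            * (Real.exp (-L u) * Real.exp (conePot ε (a u) r))
            - Real.exp (-L u) * Real.exp (conePot ε (a u) r) * coneW ε c (a u) r / coneRad ε r)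
          * coneDev ε (a u) r
        - c ^ 2 / 2 * coneRad ε r * (Real.exp (-L u) * Real.exp (conePot ε (a u) r))
          * coneMean ε (a u) r

/-- The factor `e^{ν + λ}`. -/
def flowE (ε : ℝ) (a : ℝ → ℝ → ℝ) (L : ℝ → ℝ) (u r : ℝ) : ℝ :=
  Real.exp (-L u) * Real.exp (conePot ε (a u) r)

/-- The coefficient `ḡ`. -/
def flowG (ε c : ℝ) (a : ℝ → ℝ → ℝ) (L : ℝ → ℝ) (u r : ℝ) : ℝ :=
  flowE ε a L u r * coneW ε c (a u) r / coneRad ε r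

/-- The field `ξ = 2 (r + ε) D h̄`. -/
def flowXi (ε c : ℝ) (a a' : ℝ → ℝ → ℝ) (L : ℝ → ℝ) (u r : ℝ) : ℝ :=
  2 * coneRad ε r * coneMean ε (a' u) r - flowG ε c a L u r * coneDev ε (a u) r

theorem coneDensity_nonneg {ε : ℝ} (hε : 0 < ε) (f : ℝ → ℝ) (r : ℝ) : 0 ≤ coneDensity ε f r :=
  div_nonneg (mul_nonneg (by positivity) (mul_self_nonneg _)) (coneRad_pos hε r).le

theorem coneSource_le_one (ε c : ℝ) (f : ℝ → ℝ) (r : ℝ) : coneSource ε c f r ≤ 1 := by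
  have : 0 ≤ 4 * c ^ 2 * Real.pi * coneRad ε r ^ 2 * (coneMean ε f r * coneMean ε f r) :=
    mul_nonneg (by positivity) (mul_self_nonneg _)
  unfold coneSource
  linarith

theorem monotone_conePot {ε : ℝ} (hε : 0 < ε) {f : ℝ → ℝ} (hf : Continuous f) :
    Monotone (conePot ε f) :=
  monotone_of_hasDerivAt_nonneg (hasDerivAt_conePot hε hf) fun r => coneDensity_nonneg hε f r

theorem coneW_zero (ε c : ℝ) (f : ℝ → ℝ) : coneW ε c f 0 = 0 := by simp [coneW]

theorem flowE_pos (ε : ℝ) (a : ℝ → ℝ → ℝ) (L : ℝ → ℝ) (u r : ℝ) : 0 < flowE ε a L u r :=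
  mul_pos (Real.exp_pos _) (Real.exp_pos _)

namespace IsConeFlow

variable {ε c : ℝ} {a a' b : ℝ → ℝ → ℝ} {L : ℝ → ℝ} (S : IsConeFlow ε c a a' b L)
include S

theorem hasContDerivFst_coneW : HasContDerivFst (fun u => coneW ε c (a u))
    (fun u => coneWVar ε c (a u) (a' u)) :=
  S.field.coneW S.eps_pos c

theorem hasDerivAt_W (u r : ℝ) : HasDerivAt (coneW ε c (a u))
    (coneSource ε c (a u) r - coneDensity ε (a u) r * coneW ε c (a u) r) r :=
  hasDerivAt_coneW S.eps_pos c (S.field.continuous_snd u) r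

theorem flowE_le_one {u : ℝ} (hu : 0 ≤ u) (r : ℝ) : flowE ε a L u r ≤ 1 := by
  rw [flowE, ← Real.exp_add, Real.exp_le_one_iff]
  have := (monotone_conePot S.eps_pos (S.field.continuous_snd u)).ge_of_tendsto (S.tendsto u hu) r
  linarith

theorem coneWVar_eq {u r : ℝ} (hu : 0 ≤ u) (hr : 0 ≤ r) : coneWVar ε c (a u) (a' u) r
    = 2 * Real.pi * (flowXi ε c a a' L u r ^ 2 / flowE ε a L u r
        - flowG ε c a L u r * (coneW ε c (a u) r / coneRad ε r) * coneDev ε (a u) r ^ 2) :=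
  _root_.coneWVar_eq S.eps_pos c (S.field.continuous_snd u) (S.field.continuous_snd' u)
    (Real.exp_pos (-L u)) (fun r hr => S.radial u r hu hr)
    (fun r hr => S.evolution u r hu hr) hr

theorem neg_le_coneWVar {u r : ℝ} (hu : 0 ≤ u) (hr : 0 ≤ r) :
    -(flowG ε c a L u r * coneDensity ε (a u) r * coneW ε c (a u) r / 2)
      ≤ coneWVar ε c (a u) (a' u) r := by
  have h1 : 0 ≤ 2 * Real.pi * (flowXi ε c a a' L u r ^ 2 / flowE ε a L u r) :=
    mul_nonneg (by positivity) (div_nonneg (sq_nonneg _) (flowE_pos _ _ _ _ _).le)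
  have h2 : flowG ε c a L u r * coneDensity ε (a u) r * coneW ε c (a u) r / 2
      = 2 * Real.pi * (flowG ε c a L u r * (coneW ε c (a u) r / coneRad ε r)
        * coneDev ε (a u) r ^ 2) := by
    rw [coneDensity]
    ring
  rw [S.coneWVar_eq hu hr, h2]
  linarith

/-- Positivity of `ḡ` propagates from the initial cone. -/
theorem coneW_pos (h0 : ∀ r, 0 < r → 0 < coneW ε c (a 0) r) {u r : ℝ} (hu : 0 ≤ u)
    (hr : 0 < r) : 0 < coneW ε c (a u) r := by
  by_contra hneg
  have hW := S.hasContDerivFst_coneW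
  set w : ℝ → ℝ := fun v => coneW ε c (a v) r with hw
  have hwc : Continuous w := hW.continuous_fst r
  set Z : Set ℝ := Icc 0 u ∩ w ⁻¹' Iic 0
  have hZne : Z.Nonempty := ⟨u, ⟨hu, le_rfl⟩, not_lt.1 hneg⟩
  have hZc : IsClosed Z := isClosed_Icc.inter (isClosed_Iic.preimage hwc)
  have hZb : BddBelow Z := ⟨0, fun v hv => hv.1.1⟩
  set t := sInf Z
  have htZ : t ∈ Z := hZc.csInf_mem hZne hZb
  have hpos : ∀ v ∈ Ico 0 t, 0 < w v := fun v hv => by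
    by_contra hv'
    exact (csInf_le hZb ⟨⟨hv.1, hv.2.le.trans htZ.1.2⟩, not_lt.1 hv'⟩).not_gt hv.2
  have hκc : Continuous fun v => coneDensity ε (a v) r * w v / coneRad ε r :=
    (((S.field.coneDensity S.eps_pos).continuous_fst r).mul hwc).div_const _
  obtain ⟨K, hK⟩ := (isCompact_Icc (a := (0 : ℝ)) (b := t)).exists_bound_of_continuousOn
    hκc.continuousOn
  have hmono : MonotoneOn (fun v => w v * Real.exp (K * v)) (Icc 0 t) := by
    have hd : ∀ v, HasDerivAt (fun v => w v * Real.exp (K * v))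
        (coneWVar ε c (a v) (a' v) r * Real.exp (K * v) + w v * (Real.exp (K * v) * (K * 1))) v :=
      fun v => (hW.deriv v r).mul (((hasDerivAt_id v).const_mul K).exp)
    refine monotoneOn_of_deriv_nonneg (convex_Icc _ _)
      (hwc.mul (by fun_prop)).continuousOn
      (fun v _ => (hd v).differentiableAt.differentiableWithinAt) fun v hv => ?_
    rw [interior_Icc] at hv
    rw [(hd v).deriv]
    have hwv := hpos v ⟨hv.1.le, hv.2⟩
    have hb := S.neg_le_coneWVar hv.1.le hr.le
    have hE := S.flowE_le_one hv.1.le r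
    have hE0 := flowE_pos ε a L v r
    have hKv := (le_abs_self _).trans (hK v ⟨hv.1.le, hv.2.le⟩)
    have hn : 0 ≤ coneDensity ε (a v) r * w v / coneRad ε r :=
      div_nonneg (mul_nonneg (coneDensity_nonneg S.eps_pos _ _) hwv.le)
        (coneRad_pos S.eps_pos r).le
    have h1 : flowG ε c a L v r * coneDensity ε (a v) r * coneW ε c (a v) r / 2
        = flowE ε a L v r * (coneDensity ε (a v) r * w v / coneRad ε r) * w v / 2 := by
      rw [flowG]
      ring
    have h2 : flowE ε a L v r * (coneDensity ε (a v) r * w v / coneRad ε r) ≤ K := by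
      nlinarith
    have h3 : 0 ≤ K := hn.trans hKv
    have h4 : 0 ≤ coneWVar ε c (a v) (a' v) r + K * w v := by
      rw [h1] at hb
      nlinarith [mul_le_mul_of_nonneg_right h2 hwv.le, mul_nonneg h3 hwv.le]
    have := mul_nonneg h4 (Real.exp_pos (K * v)).le
    linarith
  have := hmono ⟨le_rfl, htZ.1.1⟩ ⟨htZ.1.1, le_rfl⟩ htZ.1.1
  have h5 : 0 < w 0 := h0 r hr
  simp only [mul_zero, Real.exp_zero, mul_one] at this
  have h6 : w t * Real.exp (K * t) ≤ 0 :=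
    mul_nonpos_of_nonpos_of_nonneg htZ.2 (Real.exp_pos _).le
  linarith

section Positive

variable (hW : ∀ u r, 0 ≤ u → 0 < r → 0 < coneW ε c (a u) r)
include hW

/-- The Hawking mass is nondecreasing on each cone. -/
theorem antitoneOn_coneW_sub {u : ℝ} (hu : 0 ≤ u) :
    AntitoneOn (fun r => coneW ε c (a u) r - r) (Ici 0) := by
  have hd : ∀ r, HasDerivAt (fun r => coneW ε c (a u) r - r)
      (coneSource ε c (a u) r - coneDensity ε (a u) r * coneW ε c (a u) r - 1) r := fun r =>
    (S.hasDerivAt_W u r).sub (hasDerivAt_id r)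
  refine antitoneOn_of_deriv_nonpos (convex_Ici _)
    (fun r _ => (hd r).continuousAt.continuousWithinAt)
    (fun r _ => (hd r).differentiableAt.differentiableWithinAt) fun r hr => ?_
  rw [interior_Ici] at hr
  rw [(hd r).deriv]
  have h1 := coneSource_le_one ε c (a u) r
  have h2 := mul_nonneg (coneDensity_nonneg S.eps_pos (a u) r) (hW u r hu hr).le
  linarith

theorem coneW_le {u r : ℝ} (hu : 0 ≤ u) (hr : 0 ≤ r) : coneW ε c (a u) r ≤ r := by
  have := S.antitoneOn_coneW_sub hW hu self_mem_Ici hr hr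
  simp only [coneW_zero] at this
  linarith

theorem flowG_pos {u r : ℝ} (hu : 0 ≤ u) (hr : 0 < r) : 0 < flowG ε c a L u r :=
  div_pos (mul_pos (flowE_pos _ _ _ _ _) (hW u r hu hr)) (coneRad_pos S.eps_pos r)

theorem flowG_le_one {u r : ℝ} (hu : 0 ≤ u) (hr : 0 ≤ r) : flowG ε c a L u r ≤ 1 := by
  have h1 := S.flowE_le_one hu r
  have h2 := S.coneW_le hW hu hr
  have h4 := flowE_pos ε a L u r
  rw [flowG, div_le_one (coneRad_pos S.eps_pos r), coneRad_eq ε hr]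
  have h3 : 0 ≤ coneW ε c (a u) r := by
    rcases hr.eq_or_lt with rfl | hr
    · rw [coneW_zero]
    · exact (hW u r hu hr).le
  nlinarith [S.eps_pos]

/-- The mass is nonincreasing along lines of slope `-1/2`, which are steeper than all
characteristics. -/
theorem monotoneOn_coneW_line {T R : ℝ} (hR : T / 2 < R) :
    MonotoneOn (fun u => coneW ε c (a u) (R - u / 2) + u / 2) (Icc 0 T) := by
  have hd : ∀ u, HasDerivAt (fun u => coneW ε c (a u) (R - u / 2) + u / 2)
      (coneWVar ε c (a u) (a' u) (R - u / 2) + -(1 / 2) * (coneSource ε c (a u) (R - u / 2)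
        - coneDensity ε (a u) (R - u / 2) * coneW ε c (a u) (R - u / 2)) + 1 / 2) u := fun u => by
    have h1 : HasDerivAt (fun u : ℝ => R - u / 2) (-(1 / 2)) u := by
      simpa using ((hasDerivAt_id u).div_const 2).const_sub R
    have hG : Continuous fun p : ℝ × ℝ => coneSource ε c (a p.1) p.2
        - coneDensity ε (a p.1) p.2 * coneW ε c (a p.1) p.2 :=
      (S.field.coneSource S.eps_pos c).cont.sub
        ((S.field.coneDensity S.eps_pos).cont.mul S.hasContDerivFst_coneW.cont)
    have h2 := S.hasContDerivFst_coneW.hasDerivWithinAt_comp_curve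
      (G := fun u r => coneSource ε c (a u) r - coneDensity ε (a u) r * coneW ε c (a u) r)
      (h1.hasDerivWithinAt (s := univ))
      (Eventually.of_forall fun p => S.hasDerivAt_W p.1 p.2) hG.continuousAt
    exact (h2.hasDerivAt univ_mem).add ((hasDerivAt_id u).div_const 2)
  refine monotoneOn_of_deriv_nonneg (convex_Icc _ _)
    (fun u _ => (hd u).continuousAt.continuousWithinAt)
    (fun u _ => (hd u).differentiableAt.differentiableWithinAt) fun u hu => ?_
  rw [interior_Icc] at hu
  rw [(hd u).deriv]
  have hr : 0 < R - u / 2 := by linarith [hu.2]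
  have h1 := S.neg_le_coneWVar hu.1.le hr.le
  have h2 := coneSource_le_one ε c (a u) (R - u / 2)
  have h3 := mul_nonneg (coneDensity_nonneg S.eps_pos (a u) (R - u / 2))
    (hW u _ hu.1.le hr).le
  have h4 := S.flowG_le_one hW hu.1.le hr.le
  nlinarith

variable {M : ℝ} (hM : ∀ r, 0 < r → r + ε - coneW ε c (a 0) r ≤ 2 * M)
include hM

/-- The mass is bounded by the initial Bondi mass. -/
theorem mass_le {u r : ℝ} (hu : 0 ≤ u) (hr : 0 < r) :
    r + ε - coneW ε c (a u) r ≤ 2 * M := by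
  have h1 := S.monotoneOn_coneW_line hW (T := u) (R := r + u / 2) (by linarith)
    ⟨le_rfl, hu⟩ ⟨hu, le_rfl⟩ hu
  have h2 := hM (r + u / 2) (by linarith)
  simp only [zero_div, sub_zero, add_sub_cancel_right] at h1
  linarith

theorem conePot_tail_le {u R R' : ℝ} (hu : 0 ≤ u) (hR : 0 < R) (hRM : 4 * M ≤ R)
    (hRR' : R ≤ R') : conePot ε (a u) R' - conePot ε (a u) R ≤ 4 * M / R := by
  have hd : ∀ r, HasDerivAt (fun r => conePot ε (a u) r - 2 / R * (r - coneW ε c (a u) r))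
      (coneDensity ε (a u) r - 2 / R * (1 - (coneSource ε c (a u) r
        - coneDensity ε (a u) r * coneW ε c (a u) r))) r := fun r =>
    (hasDerivAt_conePot S.eps_pos (S.field.continuous_snd u) r).sub
      (((hasDerivAt_id r).sub (S.hasDerivAt_W u r)).const_mul _)
  have hanti : AntitoneOn (fun r => conePot ε (a u) r - 2 / R * (r - coneW ε c (a u) r))
      (Ici R) := by
    refine antitoneOn_of_deriv_nonpos (convex_Ici _)
      (fun r _ => (hd r).continuousAt.continuousWithinAt)
      (fun r _ => (hd r).differentiableAt.differentiableWithinAt) fun r hr => ?_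
    rw [interior_Ici] at hr
    have hrR : R < r := hr
    rw [(hd r).deriv]
    have h1 := coneSource_le_one ε c (a u) r
    have h2 := coneDensity_nonneg S.eps_pos (a u) r
    have h3 := S.mass_le hW hM hu (hR.trans hrR)
    have h4 : R / 2 ≤ coneW ε c (a u) r := by linarith [S.eps_pos]
    have h5 : coneDensity ε (a u) r * (R / 2) ≤ 1 - (coneSource ε c (a u) r
        - coneDensity ε (a u) r * coneW ε c (a u) r) := by nlinarith
    have h6 := mul_le_mul_of_nonneg_left h5 (by positivity : 0 ≤ 2 / R)
    have h7 : 2 / R * (coneDensity ε (a u) r * (R / 2)) = coneDensity ε (a u) r := by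
      field_simp
    linarith
  have h1 := hanti self_mem_Ici hRR' hRR'
  simp only at h1
  have h2 := S.mass_le hW hM hu (hR.trans_le hRR')
  have h3 := S.coneW_le hW hu hR.le
  have h4 : 2 / R * (R' - coneW ε c (a u) R') - 2 / R * (R - coneW ε c (a u) R)
      ≤ 2 / R * (2 * M) := by
    rw [← mul_sub]
    exact mul_le_mul_of_nonneg_left (by linarith [S.eps_pos]) (by positivity)
  have h5 : 2 / R * (2 * M) = 4 * M / R := by ring
  linarith

/-- The total variation of `ν + λ` is continuous in `u`, because its tails are uniformly small. -/
theorem continuousOn_total : ContinuousOn L (Ici 0) := by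
  have hunif : TendstoUniformlyOn (fun R u => conePot ε (a u) R) L atTop (Ici 0) := by
    rw [Metric.tendstoUniformlyOn_iff]
    intro η hη
    have hlim : Tendsto (fun R : ℝ => 4 * M / R) atTop (𝓝 0) :=
      tendsto_const_nhds.div_atTop tendsto_id
    filter_upwards [hlim.eventually (gt_mem_nhds hη), eventually_gt_atTop 0,
      eventually_ge_atTop (4 * M)] with R h1 h2 h3 u hu
    have hmono := (monotone_conePot S.eps_pos (S.field.continuous_snd u)).ge_of_tendsto
      (S.tendsto u hu) R
    have hle : L u - conePot ε (a u) R ≤ 4 * M / R :=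
      le_of_tendsto ((S.tendsto u hu).sub_const _) <| by
        filter_upwards [eventually_ge_atTop R] with R' hR'
        exact S.conePot_tail_le hW hM hu h2 h3 hR'
    rw [Real.dist_eq, abs_of_nonneg (by linarith)]
    linarith
  exact hunif.continuousOn (Eventually.of_forall fun R =>
    ((S.field.conePot S.eps_pos).continuous_fst R).continuousOn).frequently

end Positive

end IsConeFlow

theorem measurableSet_charDomain {δ u₁ : ℝ} {χ : ℝ → ℝ} (hχ : ContinuousOn χ (Icc 0 u₁)) :
    MeasurableSet (charDomain δ u₁ χ) := by
  rcases lt_or_ge u₁ 0 with hu | hu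
  · have : charDomain δ u₁ χ = ∅ := by
      ext p
      simp only [charDomain, mem_ofPred_eq, mem_empty_iff_false, iff_false]
      intro hp
      linarith [hp.1, hp.2.1]
    rw [this]
    exact MeasurableSet.empty
  have hc : Continuous (IccExtend hu ((Icc 0 u₁).domRestrict χ)) :=
    (continuousOn_iff_continuous_domRestrict.1 hχ).Icc_extend'
  have : charDomain δ u₁ χ
      = regionBetween (fun _ => δ) (IccExtend hu ((Icc 0 u₁).domRestrict χ)) (Ioo 0 u₁) := by
    ext p
    simp only [charDomain, regionBetween, mem_ofPred_eq, mem_Ioo, and_assoc]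
    refine and_congr_right fun h1 => and_congr_right fun h2 => and_congr_right fun _ => ?_
    rw [IccExtend_of_mem hu _ ⟨h1.le, h2.le⟩]
    rfl
  rw [this]
  exact measurableSet_regionBetween measurable_const hc.measurable measurableSet_Ioo

theorem charDomain_subset {δ u₁ B : ℝ} {χ : ℝ → ℝ} (hB : ∀ u ∈ Icc 0 u₁, χ u ≤ B) :
    charDomain δ u₁ χ ⊆ Icc 0 u₁ ×ˢ Icc δ B := fun _ hp =>
  ⟨⟨hp.1.le, hp.2.1.le⟩, ⟨hp.2.2.1.le, hp.2.2.2.le.trans (hB _ ⟨hp.1.le, hp.2.1.le⟩)⟩⟩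

theorem integrableOn_charDomain {δ u₁ : ℝ} {χ : ℝ → ℝ} (hχ : ContinuousOn χ (Icc 0 u₁))
    {F : ℝ × ℝ → ℝ} (hF : Continuous F) : IntegrableOn F (charDomain δ u₁ χ) := by
  obtain ⟨B, hB⟩ := (isCompact_Icc (a := (0 : ℝ)) (b := u₁)).exists_bound_of_continuousOn hχ
  exact (hF.continuousOn.integrableOn_compact (isCompact_Icc.prod isCompact_Icc)).mono_set
    (charDomain_subset fun u hu => (le_abs_self _).trans (hB u hu))

theorem setIntegral_charDomain {δ u₁ : ℝ} {χ : ℝ → ℝ} (hu₁ : 0 ≤ u₁)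
    (hχ : ContinuousOn χ (Icc 0 u₁)) (hδ : ∀ u ∈ Icc 0 u₁, δ ≤ χ u)
    {F : ℝ × ℝ → ℝ} (hF : Continuous F) :
    ∫ p in charDomain δ u₁ χ, F p = ∫ u in (0 : ℝ)..u₁, ∫ r in δ..χ u, F (u, r) := by
  have hm : MeasurableSet (charDomain δ u₁ χ) := measurableSet_charDomain hχ
  have hi := (integrable_indicator_iff hm).2 (integrableOn_charDomain (δ := δ) hχ hF)
  rw [← integral_indicator hm, Measure.volume_eq_prod, integral_prod _ hi,
    intervalIntegral.integral_of_le hu₁, integral_Ioc_eq_integral_Ioo,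
    ← integral_indicator measurableSet_Ioo]
  congr 1
  ext u
  by_cases hu : u ∈ Ioo 0 u₁
  · rw [indicator_of_mem hu, intervalIntegral.integral_of_le (hδ u ⟨hu.1.le, hu.2.le⟩),
      integral_Ioc_eq_integral_Ioo, ← integral_indicator measurableSet_Ioo]
    congr 1
    ext r
    by_cases hr : r ∈ Ioo δ (χ u)
    · rw [indicator_of_mem hr, indicator_of_mem (show (u, r) ∈ charDomain δ u₁ χ from
        ⟨hu.1, hu.2, hr⟩)]
    · rw [indicator_of_notMem hr, indicator_of_notMem fun h => hr h.2.2]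
  · rw [indicator_of_notMem hu, ← integral_zero ℝ ℝ]
    congr 1
    ext r
    exact indicator_of_notMem (fun h => hu ⟨h.1, h.2.1⟩) _

namespace IsConeFlow

variable {ε c : ℝ} {a a' b : ℝ → ℝ → ℝ} {L : ℝ → ℝ} (S : IsConeFlow ε c a a' b L)
  (hW : ∀ u r, 0 ≤ u → 0 < r → 0 < coneW ε c (a u) r) (hL : ContinuousOn L (Ici 0))
include S

theorem hasDerivAt_flowE (u r : ℝ) :
    HasDerivAt (flowE ε a L u) (flowE ε a L u r * coneDensity ε (a u) r) r :=
  ((hasDerivAt_conePot S.eps_pos (S.field.continuous_snd u) r).exp.const_mul _).congr_deriv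
    (by rw [flowE]; ring)

theorem hasDerivAt_flowG (u : ℝ) {r : ℝ} (hr : 0 < r) : HasDerivAt (flowG ε c a L u)
    ((coneSource ε c (a u) r * flowE ε a L u r - flowG ε c a L u r) / coneRad ε r) r := by
  refine (((S.hasDerivAt_flowE u r).mul (S.hasDerivAt_W u r)).div (hasDerivAt_coneRad ε hr)
    (coneRad_ne S.eps_pos r)).congr_deriv ?_
  have := coneRad_ne S.eps_pos r
  simp only [flowG, Pi.mul_apply]
  field_simp
  ring

/-- A solution of the characteristic equation that stays in `r > 0` decreases. -/
theorem antitoneOn_of_characteristic (hW : ∀ u r, 0 ≤ u → 0 < r → 0 < coneW ε c (a u) r)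
    {u₁ : ℝ} {χ : ℝ → ℝ} (hpos : ∀ u ∈ Icc 0 u₁, 0 < χ u)
    (hode : ∀ u ∈ Icc 0 u₁,
      HasDerivWithinAt χ (-(1 / 2) * flowG ε c a L u (χ u)) (Icc 0 u₁) u) :
    AntitoneOn χ (Icc 0 u₁) := by
  refine antitoneOn_of_hasDerivWithinAt_nonpos (convex_Icc _ _)
    (fun u hu => (hode u hu).continuousWithinAt)
    (fun u hu => (hode u (interior_subset hu)).mono interior_subset) fun u hu => ?_
  have hu' := interior_subset hu
  have := S.flowG_pos hW hu'.1 (hpos u hu')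
  linarith

include hL

theorem continuous_flowE_clamp :
    Continuous fun p : ℝ × ℝ => flowE ε a (fun u => L (max u 0)) p.1 p.2 := by
  have h1 : Continuous fun u => L (max u 0) :=
    hL.comp_continuous (by fun_prop) fun u => mem_Ici.2 (le_max_right _ _)
  exact ((h1.comp continuous_fst).neg.rexp).mul (S.field.conePot S.eps_pos).cont.rexp

theorem continuousOn_flowE :
    ContinuousOn (fun p : ℝ × ℝ => flowE ε a L p.1 p.2) (Ici 0 ×ˢ univ) :=
  (S.continuous_flowE_clamp hL).continuousOn.congr fun p hp => by
    simp [flowE, mem_Ici.1 hp.1]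

theorem continuousOn_flowG :
    ContinuousOn (fun p : ℝ × ℝ => flowG ε c a L p.1 p.2) (Ici 0 ×ˢ univ) :=
  ((S.continuousOn_flowE hL).mul S.hasContDerivFst_coneW.cont.continuousOn).div
    ((continuous_coneRad ε).comp continuous_snd).continuousOn fun p _ =>
      coneRad_ne S.eps_pos p.2

include hW

theorem exists_characteristic {u₁ r₁ : ℝ} (hu₁ : 0 ≤ u₁) (hr₁ : 0 < r₁) :
    ∃ χ : ℝ → ℝ, χ u₁ = r₁ ∧ (∀ u ∈ Icc 0 u₁, 0 < χ u) ∧ ∀ u ∈ Icc 0 u₁,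
      HasDerivWithinAt χ (-(1 / 2) * flowG ε c a L u (χ u)) (Icc 0 u₁) u := by
  set v : ℝ → ℝ → ℝ := fun u x => -(1 / 2) * flowG ε c a L u (max x r₁) with hv
  have hmax : ∀ x, 0 < max x r₁ := fun x => lt_max_of_lt_right hr₁
  have hdc : ContinuousOn (fun p : ℝ × ℝ => (coneSource ε c (a p.1) p.2 * flowE ε a L p.1 p.2
      - flowG ε c a L p.1 p.2) / coneRad ε p.2) (Icc 0 u₁ ×ˢ Icc r₁ (r₁ + u₁)) := by
    refine ContinuousOn.mono (s := Ici 0 ×ˢ univ) ?_ fun p hp => ⟨hp.1.1, trivial⟩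
    exact (((S.field.coneSource S.eps_pos c).cont.continuousOn.mul
      (S.continuousOn_flowE hL)).sub (S.continuousOn_flowG hL)).div
        ((continuous_coneRad ε).comp continuous_snd).continuousOn fun p _ =>
          coneRad_ne S.eps_pos p.2
  obtain ⟨K, hK⟩ := (isCompact_Icc.prod isCompact_Icc).exists_bound_of_continuousOn hdc
  have hPL : IsPicardLindelof v (tmin := 0) (tmax := u₁) ⟨u₁, hu₁, le_rfl⟩ r₁
      u₁.toNNReal 0 1 K.toNNReal := by
    refine ⟨fun u hu => ?_, fun x _ => ?_, fun u hu x _ => ?_, ?_⟩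
    · refine LipschitzOnWith.of_dist_le_mul fun x hx y hy => ?_
      rw [Real.coe_toNNReal _ hu₁, Metric.mem_closedBall, Real.dist_eq] at hx hy
      have hmem : ∀ z, |z - r₁| ≤ u₁ → max z r₁ ∈ Icc r₁ (r₁ + u₁) := fun z hz =>
        ⟨le_max_right _ _, max_le (by linarith [(abs_le.1 hz).2]) (by linarith)⟩
      have hlip := (convex_Icc r₁ (r₁ + u₁)).norm_image_sub_le_of_norm_hasDerivWithin_le
        (f := flowG ε c a L u)
        (fun z hz => (S.hasDerivAt_flowG u (hr₁.trans_le hz.1)).hasDerivWithinAt)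
        (fun z hz => hK (u, z) ⟨hu, hz⟩) (hmem y hy) (hmem x hx)
      have hmx : |max x r₁ - max y r₁| ≤ |x - y| := abs_max_sub_max_le_abs x y r₁
      have hK0 : 0 ≤ (K.toNNReal : ℝ) := K.toNNReal.2
      have hKK : K ≤ K.toNNReal := Real.le_coe_toNNReal K
      simp only [Real.norm_eq_abs] at hlip
      have h1 : dist (v u x) (v u y)
          = 1 / 2 * |flowG ε c a L u (max x r₁) - flowG ε c a L u (max y r₁)| := by
        rw [Real.dist_eq, hv]
        simp only
        rw [← mul_sub, abs_mul]
        norm_num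
      rw [h1, Real.dist_eq]
      have h2 : |flowG ε c a L u (max x r₁) - flowG ε c a L u (max y r₁)|
          ≤ K.toNNReal * |x - y| :=
        hlip.trans (mul_le_mul hKK hmx (abs_nonneg _) hK0)
      linarith [abs_nonneg (flowG ε c a L u (max x r₁) - flowG ε c a L u (max y r₁))]
    · exact continuousOn_const.mul ((S.continuousOn_flowG hL).comp
        (f := fun u => (u, max x r₁)) (by fun_prop) fun u hu => ⟨hu.1, trivial⟩)
    · have h1 := S.flowG_pos hW hu.1 (hmax x)
      have h2 := S.flowG_le_one hW hu.1 (hmax x).le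
      rw [hv, Real.norm_eq_abs, abs_le]
      simp only [NNReal.coe_one]
      constructor <;> linarith
    · simp [hu₁]
  obtain ⟨χ, hχ1, hχ⟩ := hPL.exists_eq_forall_mem_Icc_hasDerivWithinAt₀
  have hanti : AntitoneOn χ (Icc 0 u₁) := by
    refine antitoneOn_of_hasDerivWithinAt_nonpos (convex_Icc _ _)
      (fun u hu => (hχ u hu).continuousWithinAt)
      (fun u hu => (hχ u (interior_subset hu)).mono interior_subset) fun u hu => ?_
    have := S.flowG_pos hW (interior_subset hu).1 (hmax (χ u))
    simp only [hv]
    linarith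
  have hge : ∀ u ∈ Icc 0 u₁, r₁ ≤ χ u := fun u hu => by
    have h := hanti hu ⟨hu₁, le_rfl⟩ hu.2
    rwa [hχ1] at h
  refine ⟨χ, hχ1, fun u hu => hr₁.trans_le (hge u hu), fun u hu => ?_⟩
  have := hχ u hu
  simpa only [hv, max_eq_left (hge u hu)] using this

end IsConeFlow

/-- The function `e^{ν + λ} / ḡ`. -/
def flowRatio (ε c : ℝ) (a : ℝ → ℝ → ℝ) (u r : ℝ) : ℝ := coneRad ε r / coneW ε c (a u) r

/-- The derivative of `flowRatio` in `u`. -/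
def flowRatioVar (ε c : ℝ) (a a' : ℝ → ℝ → ℝ) (u r : ℝ) : ℝ :=
  -(coneRad ε r * coneWVar ε c (a u) (a' u) r) / coneW ε c (a u) r ^ 2

/-- The function `(e^{ν + λ} / ḡ²) (ξ² / (r + ε))`. -/
def flowFlux (ε c : ℝ) (a a' : ℝ → ℝ → ℝ) (L : ℝ → ℝ) (u r : ℝ) : ℝ :=
  flowE ε a L u r / flowG ε c a L u r ^ 2 * (flowXi ε c a a' L u r ^ 2 / coneRad ε r)

namespace IsConeFlow

variable {ε c : ℝ} {a a' b : ℝ → ℝ → ℝ} {L : ℝ → ℝ} (S : IsConeFlow ε c a a' b L)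
  (hW : ∀ u r, 0 ≤ u → 0 < r → 0 < coneW ε c (a u) r) (hL : ContinuousOn L (Ici 0))
include S hW

theorem flowRatioVar_eq {u r : ℝ} (hu : 0 ≤ u) (hr : 0 < r) : flowRatioVar ε c a a' u r
    = 1 / 2 * (flowE ε a L u r * coneDensity ε (a u) r)
      - 2 * Real.pi * flowFlux ε c a a' L u r := by
  have h1 := coneRad_ne S.eps_pos r
  have h2 := (flowE_pos ε a L u r).ne'
  have h3 := (hW u r hu hr).ne'
  rw [flowRatioVar, S.coneWVar_eq hu hr.le, flowFlux, coneDensity]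
  generalize flowXi ε c a a' L u r = x
  rw [flowG]
  field_simp
  ring

theorem hasContDerivFst_flowRatio {δ : ℝ} (hδ : 0 < δ) :
    HasContDerivFst (quadrantExt δ (flowRatio ε c a) (flowRatioVar ε c a a'))
      (fun u r => flowRatioVar ε c a a' (max u 0) (max r δ)) := by
  have hρ : Continuous fun p : ℝ × ℝ => coneRad ε p.2 :=
    (continuous_coneRad ε).comp continuous_snd
  have hw := S.hasContDerivFst_coneW
  have h0 : ∀ p ∈ Ici (0 : ℝ) ×ˢ Ici δ, coneW ε c (a p.1) p.2 ≠ 0 := fun p hp =>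
    (hW p.1 p.2 hp.1 (hδ.trans_le hp.2)).ne'
  refine hasContDerivFst_quadrantExt (hρ.continuousOn.div hw.cont.continuousOn h0)
    ((hρ.mul hw.cont').neg.continuousOn.div (hw.cont.pow 2).continuousOn
      fun p hp => pow_ne_zero 2 (h0 p hp)) fun u r hu hr => ?_
  refine (((hasDerivAt_const u (coneRad ε r)).div (hw.deriv u r)
    (h0 (u, r) ⟨hu, hr⟩)).congr_deriv ?_).hasDerivWithinAt
  simp only [flowRatioVar]
  ring

theorem continuousOn_flowRatio {u : ℝ} (hu : 0 ≤ u) :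
    ContinuousOn (flowRatio ε c a u) (Ioi 0) :=
  (continuous_coneRad ε).continuousOn.div
    (S.hasContDerivFst_coneW.continuous_snd u).continuousOn fun r hr => (hW u r hu hr).ne'

include hL

theorem exists_continuous_flux {δ : ℝ} (hδ : 0 < δ) : ∃ Φ : ℝ × ℝ → ℝ, Continuous Φ ∧
    ∀ u r, 0 ≤ u → δ ≤ r → Φ (u, r) = flowFlux ε c a a' L u r := by
  refine ⟨fun p => (1 / 2 * (flowE ε a (fun u => L (max u 0)) p.1 p.2
    * coneDensity ε (a p.1) p.2) - flowRatioVar ε c a a' (max p.1 0) (max p.2 δ))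
      / (2 * Real.pi), ?_, fun u r hu hr => ?_⟩
  · exact ((continuous_const.mul ((S.continuous_flowE_clamp hL).mul
      (S.field.coneDensity S.eps_pos).cont)).sub
        (S.hasContDerivFst_flowRatio hW hδ).cont').div_const _
  · have h1 : flowE ε a (fun u => L (max u 0)) u r = flowE ε a L u r := by simp [flowE, hu]
    simp only [h1, max_eq_left hu, max_eq_left hr,
      S.flowRatioVar_eq hW hu (hδ.trans_le hr)]
    have := Real.pi_ne_zero
    field_simp
    ring

theorem flux_identity {δ u₁ : ℝ} {χ : ℝ → ℝ} (hδ : 0 < δ) (hu₁ : 0 ≤ u₁)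
    (hχδ : ∀ u ∈ Icc 0 u₁, δ < χ u)
    (hode : ∀ u ∈ Icc 0 u₁,
      HasDerivWithinAt χ (-(1 / 2) * flowG ε c a L u (χ u)) (Icc 0 u₁) u) :
    IntegrableOn (fun p : ℝ × ℝ => flowFlux ε c a a' L p.1 p.2) (charDomain δ u₁ χ) ∧
    (∫ r in δ..χ u₁, flowRatio ε c a u₁ r)
        + 2 * Real.pi * (∫ p in charDomain δ u₁ χ, flowFlux ε c a a' L p.1 p.2)
        + 1 / 2 * (∫ u in (0 : ℝ)..u₁, flowE ε a L u δ)
      = ∫ r in δ..χ 0, flowRatio ε c a 0 r := by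
  obtain ⟨Φ, hΦ, hΦeq⟩ := S.exists_continuous_flux hW hL hδ
  have hχc : ContinuousOn χ (Icc 0 u₁) := fun u hu => (hode u hu).continuousWithinAt
  have hcongr : EqOn Φ (fun p : ℝ × ℝ => flowFlux ε c a a' L p.1 p.2) (charDomain δ u₁ χ) :=
    fun p hp => hΦeq p.1 p.2 hp.1.le hp.2.2.1.le
  have hm := measurableSet_charDomain (δ := δ) hχc
  refine ⟨(integrableOn_charDomain hχc hΦ).congr_fun hcongr hm, ?_⟩
  rw [← setIntegral_congr_fun hm hcongr,
    setIntegral_charDomain hu₁ hχc (fun u hu => (hχδ u hu).le) hΦ]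
  have hR := S.hasContDerivFst_flowRatio hW hδ
  set J : ℝ → ℝ := fun u =>
    ∫ r in δ..χ u, quadrantExt δ (flowRatio ε c a) (flowRatioVar ε c a a') u r with hJ
  have hJeq : ∀ u ∈ Icc 0 u₁, J u = ∫ r in δ..χ u, flowRatio ε c a u r := fun u hu => by
    refine intervalIntegral.integral_congr fun r hr => ?_
    rw [uIcc_of_le (hχδ u hu).le] at hr
    exact quadrantExt_eq _ _ hu.1 hr.1
  have hEc : ContinuousOn (fun u => flowE ε a L u δ) (Icc 0 u₁) :=
    (S.continuousOn_flowE hL).comp (f := fun u => (u, δ)) (by fun_prop)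
      fun u hu => ⟨hu.1, trivial⟩
  have hIc : ContinuousOn (fun u => ∫ r in δ..χ u, Φ (u, r)) (Icc 0 u₁) := by
    have h1 : Continuous fun p : ℝ × ℝ => ∫ r in δ..p.2, Φ (p.1, r) :=
      intervalIntegral.continuous_parametric_intervalIntegral_of_continuous
        (f := fun (p : ℝ × ℝ) s => Φ (p.1, s))
        (hΦ.comp (by fun_prop : Continuous fun x : (ℝ × ℝ) × ℝ => (x.1.1, x.2)))
        continuous_snd
    exact h1.comp_continuousOn (continuousOn_id.prodMk hχc)
  have hJd : ∀ u ∈ Icc 0 u₁, HasDerivWithinAt J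
      (-(1 / 2) * flowE ε a L u δ - 2 * Real.pi * ∫ r in δ..χ u, Φ (u, r)) (Icc 0 u₁) u :=
    fun u hu => by
    refine (hR.hasDerivWithinAt_integral_curve δ (hode u hu)).congr_deriv ?_
    have hle := (hχδ u hu).le
    have hχ0 := hδ.trans (hχδ u hu)
    have hEk : Continuous fun r => flowE ε a L u r * coneDensity ε (a u) r :=
      (continuous_const.mul
        ((S.field.conePot S.eps_pos).continuous_snd u).rexp).mul
          ((S.field.coneDensity S.eps_pos).continuous_snd u)
    have hΦu : Continuous fun r => Φ (u, r) := hΦ.comp (by fun_prop)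
    have h1 : ∫ r in δ..χ u, flowRatioVar ε c a a' (max u 0) (max r δ)
        = 1 / 2 * (∫ r in δ..χ u, flowE ε a L u r * coneDensity ε (a u) r)
          - 2 * Real.pi * ∫ r in δ..χ u, Φ (u, r) := by
      rw [← intervalIntegral.integral_const_mul, ← intervalIntegral.integral_const_mul,
        ← intervalIntegral.integral_sub
          ((hEk.intervalIntegrable _ _).const_mul _)
          ((hΦu.intervalIntegrable _ _).const_mul _)]
      refine intervalIntegral.integral_congr fun r hr => ?_
      rw [uIcc_of_le hle] at hr
      simp only [max_eq_left hu.1, max_eq_left hr.1, hΦeq u r hu.1 hr.1,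
        S.flowRatioVar_eq hW hu.1 (hδ.trans_le hr.1)]
    have h2 : ∫ r in δ..χ u, flowE ε a L u r * coneDensity ε (a u) r
        = flowE ε a L u (χ u) - flowE ε a L u δ :=
      intervalIntegral.integral_eq_sub_of_hasDerivAt (fun r _ => S.hasDerivAt_flowE u r)
        (hEk.intervalIntegrable _ _)
    have h3 : flowG ε c a L u (χ u) * flowRatio ε c a u (χ u) = flowE ε a L u (χ u) := by
      have := (hW u _ hu.1 hχ0).ne'
      have := coneRad_ne S.eps_pos (χ u)
      rw [flowG, flowRatio]
      field_simp
    rw [h1, h2, quadrantExt_eq _ _ hu.1 hle]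
    linear_combination (-1 / 2) * h3
  have hint : IntervalIntegrable (fun u => -(1 / 2) * flowE ε a L u δ
      - 2 * Real.pi * ∫ r in δ..χ u, Φ (u, r)) volume 0 u₁ :=
    ((continuousOn_const.mul hEc).sub (continuousOn_const.mul hIc)).intervalIntegrable_of_Icc hu₁
  have hftc := intervalIntegral.integral_eq_sub_of_hasDerivAt_of_le hu₁
    (fun u hu => (hJd u hu).continuousWithinAt)
    (fun u hu => (hJd u (Ioo_subset_Icc_self hu)).hasDerivAt (Icc_mem_nhds hu.1 hu.2)) hint
  rw [intervalIntegral.integral_sub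
      ((hEc.intervalIntegrable_of_Icc hu₁).const_mul _)
      ((hIc.intervalIntegrable_of_Icc hu₁).const_mul _),
    intervalIntegral.integral_const_mul, intervalIntegral.integral_const_mul,
    hJeq u₁ ⟨hu₁, le_rfl⟩, hJeq 0 ⟨le_rfl, hu₁⟩] at hftc
  linarith

end IsConeFlow

section Transfer

/-! The quantities of a field `g` on a cone expressed by those of a continuous function `f` on the
line that agrees with `g` on `[0, ∞)`. -/

variable {ε : ℝ} {f g : ℝ → ℝ} (hgf : ∀ r, 0 ≤ r → g r = f r)
include hgf

theorem epsMean_eq_coneMean {r : ℝ} (hr : 0 ≤ r) : epsMean ε g r = coneMean ε f r := by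
  rw [coneMean_eq f hr, epsMean, epsMean]
  congr 1
  refine intervalIntegral.integral_congr fun s hs => hgf s ?_
  rw [uIcc_of_le hr] at hs
  exact hs.1

theorem four_pi_mul_metricDensity {r : ℝ} (hr : 0 ≤ r) :
    4 * Real.pi * metricDensity ε g r = coneDensity ε f r := by
  rw [metricDensity, coneDensity, epsMean_eq_coneMean hgf hr, hgf r hr, coneRad_eq ε hr, coneDev]
  ring

variable (hε : 0 < ε) (hi : IntegrableOn (metricDensity ε g) (Ioi 0))
include hi

theorem conePot_eq_integral {r : ℝ} (hr : 0 ≤ r) :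
    conePot ε f r = 4 * Real.pi * (∫ s in Ioi 0, metricDensity ε g s) + nuPlusLam ε g r := by
  have h1 : conePot ε f r = 4 * Real.pi * ∫ s in (0 : ℝ)..r, metricDensity ε g s := by
    rw [conePot, ← intervalIntegral.integral_const_mul]
    refine intervalIntegral.integral_congr fun s hs => ?_
    rw [uIcc_of_le hr] at hs
    exact (four_pi_mul_metricDensity hgf hs.1).symm
  have h2 := intervalIntegral.integral_interval_add_Ioi hi
    (hi.mono_set (Ioi_subset_Ioi hr))
  rw [h1, ← h2, nuPlusLam]
  ring

theorem exp_nuPlusLam {r : ℝ} (hr : 0 ≤ r) : Real.exp (nuPlusLam ε g r)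
    = Real.exp (-(4 * Real.pi * ∫ s in Ioi 0, metricDensity ε g s)) * Real.exp (conePot ε f r) := by
  rw [← Real.exp_add, conePot_eq_integral hgf hi hr]
  congr 1
  ring

theorem tendsto_conePot :
    Tendsto (conePot ε f) atTop (𝓝 (4 * Real.pi * ∫ s in Ioi 0, metricDensity ε g s)) := by
  refine ((intervalIntegral_tendsto_integral_Ioi 0 hi tendsto_id).const_mul
    (4 * Real.pi)).congr' ?_
  filter_upwards [eventually_ge_atTop 0] with r hr
  rw [conePot, ← intervalIntegral.integral_const_mul]
  refine intervalIntegral.integral_congr fun s hs => ?_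
  rw [id, uIcc_of_le hr] at hs
  exact four_pi_mul_metricDensity hgf hs.1

theorem coefG_eq (c : ℝ) {r : ℝ} (hr : 0 ≤ r) : coefG ε c g r = coneSource ε c f r
    * (Real.exp (-(4 * Real.pi * ∫ s in Ioi 0, metricDensity ε g s))
      * Real.exp (conePot ε f r)) := by
  rw [coefG, exp_nuPlusLam hgf hi hr, epsMean_eq_coneMean hgf hr, coneSource, coneRad_eq ε hr]
  ring

theorem coefGbar_eq (c : ℝ) {r : ℝ} (hr : 0 ≤ r) : coefGbar ε c g r
    = Real.exp (-(4 * Real.pi * ∫ s in Ioi 0, metricDensity ε g s)) * Real.exp (conePot ε f r)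
      * coneW ε c f r / coneRad ε r := by
  have h1 : ∫ s in (0 : ℝ)..r, coefG ε c g s
      = Real.exp (-(4 * Real.pi * ∫ s in Ioi 0, metricDensity ε g s))
        * ∫ s in (0 : ℝ)..r, coneSource ε c f s * Real.exp (conePot ε f s) := by
    rw [← intervalIntegral.integral_const_mul]
    refine intervalIntegral.integral_congr fun s hs => ?_
    rw [uIcc_of_le hr] at hs
    simp only [coefG_eq hgf hi c hs.1]
    ring
  have := (Real.exp_pos (conePot ε f r)).ne'
  rw [coefGbar, epsMean, h1, coneRad_eq ε hr, coneW]
  field_simp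

include hε

theorem hawkingMass_eq (c : ℝ) {r : ℝ} (hr : 0 ≤ r) :
    hawkingMass ε c g r = (r + ε - coneW ε c f r) / 2 := by
  have h1 := (Real.exp_pos (conePot ε f r)).ne'
  have h2 := (Real.exp_pos (-(4 * Real.pi * ∫ s in Ioi 0, metricDensity ε g s))).ne'
  have h3 : r + ε ≠ 0 := by linarith
  rw [hawkingMass, coefGbar_eq hgf hi c hr, exp_nuPlusLam hgf hi hr, coneRad_eq ε hr]
  field_simp

end Transfer

/-- The total variation of `ν + λ` on the cone `u`. -/
def totalVar (ε : ℝ) (h : ℝ → ℝ → ℝ) (u : ℝ) : ℝ :=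
  4 * Real.pi * ∫ s in Ioi 0, metricDensity ε (h u) s

/-- A classical solution, extended to the plane, is a solution in the sense of `IsConeFlow`. -/
theorem IsGlobalClassicalSolution.exists_coneFlow {ε c : ℝ} (hε : 0 < ε) {h₀ : ℝ → ℝ}
    {h : ℝ → ℝ → ℝ} (hsol : IsGlobalClassicalSolution ε c h₀ h) :
    ∃ a a' b : ℝ → ℝ → ℝ, IsConeFlow ε c a a' b (totalVar ε h) ∧
      ∀ u r, 0 ≤ u → 0 ≤ r → h u r = a u r := by
  obtain ⟨hu, hr, hc, hdu, hdr⟩ := hsol.contDiffOn.exists_quadrant_partials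
  have hext : ∀ u r, 0 ≤ u → 0 ≤ r → h u r = quadrantExt 0 h hu u r := fun u r h1 h2 =>
    (quadrantExt_eq h hu h1 h2).symm
  refine ⟨quadrantExt 0 h hu, fun u r => hu (max u 0) (max r 0), hr,
    ⟨hε, hasContDerivFst_quadrantExt hsol.contDiffOn.continuousOn hc hdu, ?_, ?_, ?_⟩, hext⟩
  · intro u r h1 h2
    refine (hdr u r h1 h2).congr_of_eventuallyEq ?_
    filter_upwards [Ioi_mem_nhds h2] with s hs
    exact (hext u s h1 (mem_Ioi.1 hs).le).symm
  · exact fun u h1 => tendsto_conePot (hext u · h1) (hsol.integrable u h1)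
  · intro u r h1 h2
    have hev := hsol.evolution u r h1 h2
    have hi := hsol.integrable u h1
    rw [nullDeriv, (hdu u r h1 h2.le).derivWithin (uniqueDiffOn_Ici 0 u h1),
      show deriv (fun s => h u s) r = hr u r from (hdr u r h1 h2).deriv,
      coefG_eq (hext u · h1) hi c h2.le, coefGbar_eq (hext u · h1) hi c h2.le,
      exp_nuPlusLam (hext u · h1) hi h2.le, epsMean_eq_coneMean (hext u · h1) h2.le,
      hext u r h1 h2.le, ← coneRad_eq ε h2.le] at hev
    simp only [max_eq_left h1, max_eq_left h2.le, totalVar, coneDev]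
    linear_combination hev

section Solution

variable {ε c : ℝ} {h a a' b : ℝ → ℝ → ℝ}
  (S : IsConeFlow ε c a a' b (totalVar ε h)) (hext : ∀ u r, 0 ≤ u → 0 ≤ r → h u r = a u r)
  (hi : ∀ u, 0 ≤ u → IntegrableOn (metricDensity ε (h u)) (Ioi 0))
include hext

include S in
theorem hasDerivWithinAt_epsMean {u r : ℝ} (hu : 0 ≤ u) (hr : 0 ≤ r) :
    HasDerivWithinAt (fun v => epsMean ε (h v) r) (coneMean ε (a' u) r) (Ici 0) u :=
  ((S.field.coneMean S.eps_pos).deriv u r).hasDerivWithinAt.congr_of_mem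
    (fun v hv => epsMean_eq_coneMean (hext v · hv) hr) hu

include S in
theorem hasDerivAt_epsMean {u r : ℝ} (hu : 0 ≤ u) (hr : 0 < r) :
    HasDerivAt (epsMean ε (h u)) (coneDev ε (a u) r / coneRad ε r) r := by
  refine (hasDerivAt_coneMean S.eps_pos (S.field.continuous_snd u) hr).congr_of_eventuallyEq ?_
  filter_upwards [Ioi_mem_nhds hr] with s hs
  exact epsMean_eq_coneMean (hext u · hu) (mem_Ioi.1 hs).le

include hi

theorem exp_nuPlusLam_eq_flowE {u r : ℝ} (hu : 0 ≤ u) (hr : 0 ≤ r) :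
    Real.exp (nuPlusLam ε (h u) r) = flowE ε a (totalVar ε h) u r :=
  exp_nuPlusLam (hext u · hu) (hi u hu) hr

theorem coefGbar_eq_flowG {u r : ℝ} (hu : 0 ≤ u) (hr : 0 ≤ r) :
    coefGbar ε c (h u) r = flowG ε c a (totalVar ε h) u r :=
  coefGbar_eq (hext u · hu) (hi u hu) c hr

include S

theorem hasDerivWithinAt_hawkingMass {u r : ℝ} (hu : 0 ≤ u) (hr : 0 ≤ r) :
    HasDerivWithinAt (fun v => hawkingMass ε c (h v) r) (-coneWVar ε c (a u) (a' u) r / 2)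
      (Ici 0) u :=
  (((S.hasContDerivFst_coneW.deriv u r).const_sub (r + ε)).div_const 2).hasDerivWithinAt.congr_of_mem
    (fun v hv => hawkingMass_eq (hext v · hv) S.eps_pos (hi v hv) c hr) hu

theorem hasDerivAt_hawkingMass {u r : ℝ} (hu : 0 ≤ u) (hr : 0 < r) :
    HasDerivAt (hawkingMass ε c (h u)) ((1 - (coneSource ε c (a u) r
      - coneDensity ε (a u) r * coneW ε c (a u) r)) / 2) r := by
  refine ((((hasDerivAt_id r).add_const ε).sub (S.hasDerivAt_W u r)).div_const
    2).congr_of_eventuallyEq ?_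
  filter_upwards [Ioi_mem_nhds hr] with s hs
  exact hawkingMass_eq (hext u · hu) S.eps_pos (hi u hu) c (mem_Ioi.1 hs).le

theorem nullDeriv_epsMean {u r : ℝ} (hu : 0 ≤ u) (hr : 0 < r) :
    nullDeriv ε c h (fun v s => epsMean ε (h v) s) u r
      = flowXi ε c a a' (totalVar ε h) u r / (2 * coneRad ε r) := by
  rw [nullDeriv, (hasDerivWithinAt_epsMean S hext hu hr.le).derivWithin (uniqueDiffOn_Ici 0 u hu),
    show deriv (fun s => epsMean ε (h u) s) r = _ from (hasDerivAt_epsMean S hext hu hr).deriv,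
    coefGbar_eq_flowG hext hi hu hr.le, flowXi]
  have := coneRad_ne S.eps_pos r
  field_simp

theorem xiField_eq {u r : ℝ} (hu : 0 ≤ u) (hr : 0 < r) :
    xiField ε c h u r = flowXi ε c a a' (totalVar ε h) u r := by
  rw [xiField, nullDeriv_epsMean S hext hi hu hr, coneRad_eq ε hr.le]
  have : r + ε ≠ 0 := by linarith [S.eps_pos]
  field_simp

theorem nullDeriv_hawkingMass {u r : ℝ} (hu : 0 ≤ u) (hr : 0 < r) :
    nullDeriv ε c h (fun v s => hawkingMass ε c (h v) s) u r
        = -(4 * Real.pi / Real.exp (nuPlusLam ε (h u) r)) * (r + ε) ^ 2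
              * nullDeriv ε c h (fun v s => epsMean ε (h v) s) u r ^ 2
            - c ^ 2 * Real.pi * (r + ε) ^ 2 * epsMean ε (h u) r ^ 2 * coefGbar ε c (h u) r := by
  rw [nullDeriv_epsMean S hext hi hu hr, nullDeriv,
    (hasDerivWithinAt_hawkingMass S hext hi hu hr.le).derivWithin (uniqueDiffOn_Ici 0 u hu),
    show deriv (fun s => hawkingMass ε c (h u) s) r = _ from
      (hasDerivAt_hawkingMass S hext hi hu hr).deriv,
    coefGbar_eq_flowG hext hi hu hr.le, exp_nuPlusLam_eq_flowE hext hi hu hr.le,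
    S.coneWVar_eq hu hr.le, epsMean_eq_coneMean (hext u · hu) hr.le, ← coneRad_eq ε hr.le,
    coneSource, coneDensity]
  have h1 := coneRad_ne S.eps_pos r
  have h2 := (flowE_pos ε a (totalVar ε h) u r).ne'
  field_simp
  ring

theorem metricRatio_eq {u r : ℝ} (hu : 0 ≤ u) (hr : 0 ≤ r) :
    metricRatio ε c h u r = flowRatio ε c a u r := by
  have h1 := coneRad_ne S.eps_pos r
  have h2 := (flowE_pos ε a (totalVar ε h) u r).ne'
  rw [metricRatio, exp_nuPlusLam_eq_flowE hext hi hu hr, coefGbar_eq_flowG hext hi hu hr, flowG,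
    flowRatio]
  field_simp

theorem fluxDensity_eq {u r : ℝ} (hu : 0 ≤ u) (hr : 0 < r) :
    fluxDensity ε c h u r = flowFlux ε c a a' (totalVar ε h) u r := by
  rw [fluxDensity, exp_nuPlusLam_eq_flowE hext hi hu hr.le, coefGbar_eq_flowG hext hi hu hr.le,
    xiField_eq S hext hi hu hr, ← coneRad_eq ε hr.le, flowFlux]

end Solution

theorem IsCharacteristic.ode_flow {ε c : ℝ} {h a : ℝ → ℝ → ℝ} {u₁ r₁ : ℝ} {χ : ℝ → ℝ}
    (hχ : IsCharacteristic ε c h u₁ r₁ χ) (hext : ∀ u r, 0 ≤ u → 0 ≤ r → h u r = a u r)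
    (hi : ∀ u, 0 ≤ u → IntegrableOn (metricDensity ε (h u)) (Ioi 0)) :
    ∀ u ∈ Icc 0 u₁, HasDerivWithinAt χ (-(1 / 2) * flowG ε c a (totalVar ε h) u (χ u))
      (Icc 0 u₁) u := fun u hu => by
  rw [← coefGbar_eq_flowG hext hi hu.1 (hχ.pos u hu).le]
  exact hχ.ode u hu

end

theorem corollary2p2 (ε c : ℝ) (hε : 0 < ε) (hε1 : ε < 1) (hc : 0 < c)
    (h₀ : ℝ → ℝ) (hh₀ : ContDiffOn ℝ 1 h₀ (Ici 0))
    (hmass : ∃ M : ℝ, Tendsto (hawkingMass ε c h₀) atTop (𝓝 M))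
    (hpos : ∀ r : ℝ, 0 < r → 0 < coefGbar ε c h₀ r)
    (h : ℝ → ℝ → ℝ) (hsol : IsGlobalClassicalSolution ε c h₀ h) :
    (∀ u r : ℝ, 0 ≤ u → 0 < r →
      0 < coefGbar ε c (h u) r ∧
      HasPartials (fun v s => hawkingMass ε c (h v) s) u r ∧
      HasPartials (fun v s => epsMean ε (h v) s) u r ∧
      nullDeriv ε c h (fun v s => hawkingMass ε c (h v) s) u r
        = -(4 * Real.pi / Real.exp (nuPlusLam ε (h u) r)) * (r + ε) ^ 2
              * nullDeriv ε c h (fun v s => epsMean ε (h v) s) u r ^ 2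
            - c ^ 2 * Real.pi * (r + ε) ^ 2 * epsMean ε (h u) r ^ 2 * coefGbar ε c (h u) r) ∧
    (∀ δ u₁ r₁ : ℝ, 0 < δ → 0 ≤ u₁ → δ < r₁ →
      (∃ χ : ℝ → ℝ, IsCharacteristic ε c h u₁ r₁ χ) ∧
      ∀ χ : ℝ → ℝ, IsCharacteristic ε c h u₁ r₁ χ →
        IntervalIntegrable (metricRatio ε c h u₁) volume δ r₁ ∧
        IntegrableOn (fun p : ℝ × ℝ => fluxDensity ε c h p.1 p.2) (charDomain δ u₁ χ) ∧
        IntervalIntegrable (fun u => Real.exp (nuPlusLam ε (h u) δ)) volume 0 u₁ ∧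
        IntervalIntegrable (metricRatio ε c h 0) volume δ (χ 0) ∧
        (∫ r in δ..r₁, metricRatio ε c h u₁ r)
            + 2 * Real.pi * (∫ p in charDomain δ u₁ χ, fluxDensity ε c h p.1 p.2)
            + 1 / 2 * (∫ u in (0 : ℝ)..u₁, Real.exp (nuPlusLam ε (h u) δ))
          = ∫ r in δ..(χ 0), metricRatio ε c h 0 r) := by
  obtain ⟨a, a', b, S, hext⟩ := hsol.exists_coneFlow hε
  have hi := hsol.integrable
  have hext₀ : ∀ r, 0 ≤ r → h₀ r = a 0 r := fun r hr => by
    rw [← hsol.initial r hr, hext 0 r le_rfl hr]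
  have hi₀ : IntegrableOn (metricDensity ε h₀) (Ioi 0) := by
    refine (hi 0 le_rfl).congr_fun (fun s hs => ?_) measurableSet_Ioi
    have h1 := four_pi_mul_metricDensity (ε := ε) (hext 0 · le_rfl) (mem_Ioi.1 hs).le
    rw [← four_pi_mul_metricDensity (ε := ε) hext₀ (mem_Ioi.1 hs).le] at h1
    exact mul_left_cancel₀ (by positivity) h1
  have hW : ∀ u r, 0 ≤ u → 0 < r → 0 < coneW ε c (a u) r := fun u r hu hr => by
    refine S.coneW_pos (fun r hr => ?_) hu hr
    have h1 := hpos r hr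
    rw [coefGbar_eq hext₀ hi₀ c hr.le] at h1
    have h2 := (div_pos_iff_of_pos_right (coneRad_pos hε r)).1 h1
    exact pos_of_mul_pos_right h2 (by positivity)
  obtain ⟨M, hM⟩ := hmass
  have hbound : ∀ r, 0 < r → r + ε - coneW ε c (a 0) r ≤ 2 * M := fun r hr => by
    have h1 : hawkingMass ε c h₀ r ≤ M := by
      refine ge_of_tendsto hM ?_
      filter_upwards [eventually_ge_atTop r] with s hs
      have h2 := S.antitoneOn_coneW_sub hW le_rfl hr.le (hr.le.trans hs) hs
      rw [hawkingMass_eq hext₀ hε hi₀ c hr.le, hawkingMass_eq hext₀ hε hi₀ c (hr.le.trans hs)]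
      simp only at h2
      linarith
    rw [hawkingMass_eq hext₀ hε hi₀ c hr.le] at h1
    linarith
  have hL := S.continuousOn_total hW hbound
  refine ⟨fun u r hu hr => ⟨?_, ⟨?_, ?_⟩, ⟨?_, ?_⟩, nullDeriv_hawkingMass S hext hi hu hr⟩,
    fun δ u₁ r₁ hδ hu₁ hr₁ => ⟨?_, fun χ hχ => ?_⟩⟩
  · rw [coefGbar_eq_flowG hext hi hu hr.le]
    exact S.flowG_pos hW hu hr
  · exact (hasDerivWithinAt_hawkingMass S hext hi hu hr.le).differentiableWithinAt
  · exact (hasDerivAt_hawkingMass S hext hi hu hr).differentiableAt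
  · exact (hasDerivWithinAt_epsMean S hext hu hr.le).differentiableWithinAt
  · exact (hasDerivAt_epsMean S hext hu hr).differentiableAt
  · obtain ⟨χ, hend, hpos, hode⟩ := S.exists_characteristic hW hL hu₁ (hδ.trans hr₁)
    refine ⟨χ, hend, hpos, fun u hu => ?_⟩
    rw [coefGbar_eq_flowG hext hi hu.1 (hpos u hu).le]
    exact hode u hu
  · have hode := hχ.ode_flow hext hi
    have hχδ : ∀ u ∈ Icc 0 u₁, δ < χ u := fun u hu => by
      have h1 := S.antitoneOn_of_characteristic hW hχ.pos hode hu ⟨hu₁, le_rfl⟩ hu.2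
      rw [hχ.endpoint] at h1
      exact hr₁.trans_le h1
    obtain ⟨hint, hid⟩ := S.flux_identity hW hL hδ hu₁ hχδ hode
    have hm := measurableSet_charDomain (δ := δ) fun u hu => (hode u hu).continuousWithinAt
    have hflux : EqOn (fun p : ℝ × ℝ => flowFlux ε c a a' (totalVar ε h) p.1 p.2)
        (fun p => fluxDensity ε c h p.1 p.2) (charDomain δ u₁ χ) := fun p hp =>
      (fluxDensity_eq S hext hi hp.1.le (hδ.trans hp.2.2.1)).symm
    have hratio : ∀ u, 0 ≤ u → ∀ R, δ ≤ R →
        EqOn (metricRatio ε c h u) (flowRatio ε c a u) (uIcc δ R) := fun u hu R hR r hr => by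
      rw [uIcc_of_le hR] at hr
      exact metricRatio_eq S hext hi hu (hδ.le.trans hr.1)
    have hratio_int : ∀ u, 0 ≤ u → ∀ R, δ ≤ R →
        IntervalIntegrable (metricRatio ε c h u) volume δ R := fun u hu R hR => by
      refine ContinuousOn.intervalIntegrable (((S.continuousOn_flowRatio hW hu).mono
        fun r hr => ?_).congr (hratio u hu R hR))
      rw [uIcc_of_le hR] at hr
      exact hδ.trans_le hr.1
    have hE : EqOn (fun u => Real.exp (nuPlusLam ε (h u) δ))
        (fun u => flowE ε a (totalVar ε h) u δ) (uIcc 0 u₁) := fun u hu => by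
      rw [uIcc_of_le hu₁] at hu
      exact exp_nuPlusLam_eq_flowE hext hi hu.1 hδ.le
    have hχ₀ := (hχδ 0 ⟨le_rfl, hu₁⟩).le
    refine ⟨hratio_int u₁ hu₁ r₁ hr₁.le, hint.congr_fun hflux hm, ?_,
      hratio_int 0 le_rfl _ hχ₀, ?_⟩
    · refine ContinuousOn.intervalIntegrable (ContinuousOn.congr ?_ hE)
      refine (S.continuousOn_flowE hL).comp (f := fun u => (u, δ)) (by fun_prop) fun u hu => ?_
      rw [uIcc_of_le hu₁] at hu
      exact ⟨hu.1, trivial⟩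
    · rw [intervalIntegral.integral_congr (hratio u₁ hu₁ r₁ hr₁.le),
        intervalIntegral.integral_congr (hratio 0 le_rfl _ hχ₀),
        intervalIntegral.integral_congr hE, ← setIntegral_congr_fun hm hflux, ← hid,
        hχ.endpoint]
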